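/- Let $G$ be a finite-dimensional real Lie group with Lie algebra $\mathfrak g$, acting smoothly (from the left) on a finite-dimensional real smooth manifold $M$. (Manifolds are Hausdorff, second countable and without boundary.) For $X\in\mathfrak g$ let $X_*$ denote its action field, $(X_*)_p=\frac{d}{dt}\big|_{t=0}\exp(tX)\cdot p$, and for a linear subspace $\mathfrak m\subset\mathfrak g$ let $\mathcal D^{\mathfrak m}$ be the smooth generalized distribution $\mathcal D^{\mathfrak m}_p=\{(X_*)_p \mid X\in\mathfrak m\}\subset T_pM$. A smooth generalized distribution $\mathcal D$ on $M$, with space $\Gamma(\mathcal D)$ of smooth vector fields $X$ on $M$ such that $X_q\in\mathcal D_q$ for all $q \in M$, is called *involutive at $p$* if $[X,Y]_p\in\mathcal D_p$ for all $X,Y\in\Gamma(\mathcal D)$. An *integral leaf* of $\mathcal D$ is an immersed submanifold $N\subset M$ with $T_qN=\mathcal D_q$ for all $q\in N$, and $\mathcal D$ is *integrable at $p$* if some integral leaf contains $p$. The *maximal integral leaf through $p$* is the connected integral leaf containing $p$ of which every connected integral leaf containing $p$ is an open submanifold. For $p\in M$, the orbit $\mathcal O=G\cdot p$ carries a structure of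 an immersed submanifold of $M$ for which $G\to\mathcal O$, $g\mapsto g\cdot p$, is a smooth submersion; $\mathcal O$ is always considered with this structure (in particular, with this topology). A point $q\in\mathcal O$ is *$\mathfrak m$-regular* if $\mathcal D^{\mathfrak m}_q=T_q\mathcal O$, and $\mathcal O^{\rm reg}_{\mathfrak m}\subset\mathcal O$ denotes the set of $\mathfrak m$-regular points of $\mathcal O$. Suppose that $\mathfrak g=\mathfrak m+[\mathfrak m,\mathfrak m]$, where $[\mathfrak m,\mathfrak m]$ is the linear span of all brackets of elements of $\mathfrak m$. Then for each $p\in M$ the following are equivalent: 1. $\mathcal D^{\mathfrak m}$ is involutive at $p$; 2. $\mathcal D^{\mathfrak m}$ is integrable at $p$; 3. $p$ is an $\mathfrak m$-regular point. In this case, the maximal integral leaf of $\mathcal D^{\mathfrak m}$ through $p$ exists, and it is the connected component of $p$ in $\mathcal O^{\rm reg}_{\mathfrak m}\subset\mathcal O=G\cdot p$, as an open submanifold of $\mathcal O$. -/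

import Mathlib

open scoped Manifold ContDiff

noncomputable section

namespace GManifold

universe u

section Distributions

variable {E : Type*} [NormedAddCommGroup E] [NormedSpace ℝ E]
  {H : Type*} [TopologicalSpace H] (I : ModelWithCorners ℝ E H)
  (M : Type u) [TopologicalSpace M] [ChartedSpace H M]

/-- A generalized distribution: a linear subspace of each tangent space, of possibly varying
dimension. -/
abbrev Distribution : Type _ := (p : M) → Submodule ℝ (TangentSpace I p)

variable {I M}

section Involutive

variable [IsManifold I ∞ M]

/-- `X` is a globally defined smooth vector field on `M` with values in `D`, i.e. `X ∈ Γ(D)`. -/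
def IsSection (D : Distribution I M) (X : (p : M) → TangentSpace I p) : Prop :=
  ContMDiff I I.tangent ∞ (fun p : M => (⟨p, X p⟩ : TangentBundle I M)) ∧ ∀ p : M, X p ∈ D p

/-- The generalized distribution `[D, D]`: at `p` it is spanned by `D p` and all values `[X, Y] p`
with `X, Y ∈ Γ(D)`. -/
def bracketDistribution (D : Distribution I M) : Distribution I M := fun p =>
  D p ⊔ Submodule.span ℝ {v : TangentSpace I p | ∃ X Y : (q : M) → TangentSpace I q,
    IsSection D X ∧ IsSection D Y ∧ v = VectorField.mlieBracket I X Y p}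

/-- `D` is involutive at `p` if `[D, D]` and `D` agree at `p`. -/
def InvolutiveAt (D : Distribution I M) (p : M) : Prop :=
  bracketDistribution D p = D p

end Involutive

variable (I M)

/-- An immersed submanifold of `M`: a (Hausdorff, second countable, boundaryless) smooth manifold
together with an injective smooth map to `M` (thought of as an inclusion) all of whose
differentials are injective. Its topology may be finer than the one induced from `M`. -/
structure ImmersedSubmanifold : Type (u + 1) where
  /-- The dimension. -/
  dim : ℕ
  /-- The underlying type. -/
  carrier : Type u
  [topologicalSpace : TopologicalSpace carrier]
  [chartedSpace : ChartedSpace (EuclideanSpace ℝ (Fin dim)) carrier]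
  [isManifold : IsManifold (𝓡 dim) ∞ carrier]
  [t2Space : T2Space carrier]
  [secondCountable : SecondCountableTopology carrier]
  /-- The inclusion into the ambient manifold. -/
  incl : carrier → M
  injective_incl : Function.Injective incl
  contMDiff_incl : ContMDiff (𝓡 dim) I ∞ incl
  injective_mfderiv : ∀ q : carrier, Function.Injective (mfderiv (𝓡 dim) I incl q)

attribute [instance] ImmersedSubmanifold.topologicalSpace ImmersedSubmanifold.chartedSpace
  ImmersedSubmanifold.isManifold ImmersedSubmanifold.t2Space ImmersedSubmanifold.secondCountable

variable {I M}

namespace ImmersedSubmanifold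

/-- The tangent space of an immersed submanifold at `q`, as a subspace of the tangent space of the
ambient manifold. -/
def tangentAt (N : ImmersedSubmanifold I M) (q : N.carrier) :
    Submodule ℝ (TangentSpace I (N.incl q)) :=
  LinearMap.range (mfderiv (𝓡 N.dim) I N.incl q).toLinearMap

/-- `N` is (via the inclusions into `M`) an open submanifold of `L`. -/
def IsOpenSubmanifoldOf (N L : ImmersedSubmanifold I M) : Prop :=
  ∃ j : N.carrier → L.carrier, (∀ q, L.incl (j q) = N.incl q) ∧
    Topology.IsOpenEmbedding j ∧ ContMDiff (𝓡 N.dim) (𝓡 L.dim) ∞ j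

/-- `N` is an integral leaf of `D`: its tangent space at each of its points is given by `D`. -/
def IsIntegralLeaf (N : ImmersedSubmanifold I M) (D : Distribution I M) : Prop :=
  ∀ q : N.carrier, N.tangentAt q = D (N.incl q)

/-- `N` is a connected integral leaf of `D` that contains the point `p`. -/
structure IsConnectedLeafThrough (N : ImmersedSubmanifold I M) (D : Distribution I M) (p : M) :
    Prop where
  isIntegralLeaf : N.IsIntegralLeaf D
  connectedSpace : ConnectedSpace N.carrier
  mem_range : p ∈ Set.range N.incl

/-- `L` is the maximal integral leaf of `D` through `p`: it is a connected integral leaf through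
`p`, and every connected integral leaf through `p` is an open submanifold of `L`. -/
structure IsMaximalLeafThrough (L : ImmersedSubmanifold I M) (D : Distribution I M) (p : M) :
    Prop extends L.IsConnectedLeafThrough D p where
  maximal : ∀ N : ImmersedSubmanifold I M,
    N.IsConnectedLeafThrough D p → N.IsOpenSubmanifoldOf L

end ImmersedSubmanifold

/-- `D` is integrable at `p` if some integral leaf of `D` contains `p`. -/
def IntegrableAt (D : Distribution I M) (p : M) : Prop :=
  ∃ N : ImmersedSubmanifold I M, N.IsIntegralLeaf D ∧ p ∈ Set.range N.incl

end Distributions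

section Action

variable {EG : Type*} [NormedAddCommGroup EG] [NormedSpace ℝ EG]
  {HG : Type*} [TopologicalSpace HG] {J : ModelWithCorners ℝ EG HG}
  {G : Type*} [TopologicalSpace G] [ChartedSpace HG G] [Group G]
  {E : Type*} [NormedAddCommGroup E] [NormedSpace ℝ E]
  {H : Type*} [TopologicalSpace H] (I : ModelWithCorners ℝ E H)
  {M : Type u} [TopologicalSpace M] [ChartedSpace H M] [MulAction G M]

/-- The linear span `[𝔪, 𝔪]` of all brackets of elements of a linear subspace `𝔪` of the Lie
algebra of `G`. -/
def bracketSpan (m : Submodule ℝ (GroupLieAlgebra J G)) : Submodule ℝ (GroupLieAlgebra J G) :=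
  Submodule.span ℝ {Z | ∃ X ∈ m, ∃ Y ∈ m, Z = ⁅X, Y⁆}

/-- The map `X ↦ (X_*) p`, sending an element of the Lie algebra to the value at `p` of its action
field; it is the differential at `1` of the orbit map `g ↦ g • p`. -/
def actionField (p : M) : GroupLieAlgebra J G →L[ℝ] TangentSpace I p :=
  mfderiv J I (fun g : G => g • p) 1

/-- The generalized distribution `D^𝔪` with `D^𝔪 p = {(X_*) p | X ∈ 𝔪}`. -/
def actionDistribution (m : Submodule ℝ (GroupLieAlgebra J G)) : Distribution I M := fun p =>
  m.map (actionField I p : GroupLieAlgebra J G →L[ℝ] TangentSpace I p).toLinearMap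

variable {I}

namespace ImmersedSubmanifold

variable (J G) in
/-- The immersed submanifold `O` is the orbit `G • p` with its standard structure of an immersed
submanifold: its underlying set is the orbit, and `g ↦ g • p` is a smooth submersion `G → O`. -/
def IsOrbit (O : ImmersedSubmanifold I M) (p : M) : Prop :=
  Set.range O.incl = MulAction.orbit G p ∧
    ∃ f : G → O.carrier, (∀ g : G, O.incl (f g) = g • p) ∧
      ContMDiff J (𝓡 O.dim) ∞ f ∧
      ∀ g : G, Function.Surjective (mfderiv J (𝓡 O.dim) f g)

/-- The set of `𝔪`-regular points of `O`: those points at which `D^𝔪` is the whole tangent space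
of `O`. -/
def regularPart (O : ImmersedSubmanifold I M) (m : Submodule ℝ (GroupLieAlgebra J G)) :
    Set O.carrier :=
  {q | actionDistribution I m (O.incl q) = O.tangentAt q}

end ImmersedSubmanifold

end Action

end GManifold

end

open scoped Manifold ContDiff

noncomputable section

open Set Filter Topology

set_option linter.unusedSectionVars false

namespace GManifold

section Calculus

variable {X V E : Type*} [NormedAddCommGroup X] [NormedSpace ℝ X] [NormedAddCommGroup V]
  [NormedSpace ℝ V] [NormedAddCommGroup E] [NormedSpace ℝ E]

/-- The inverse function theorem, with smoothness of the inverse on its whole domain. -/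
theorem exists_openPartialHomeomorph_of_fderiv_eq_id [CompleteSpace X] {f : X → X} {U : Set X}
    (hU : IsOpen U) (hf : ContDiffOn ℝ ∞ f U) {x₀ : X} (hx₀ : x₀ ∈ U)
    (hid : HasFDerivAt f (ContinuousLinearMap.id ℝ X) x₀) :
    ∃ Φ : OpenPartialHomeomorph X X, x₀ ∈ Φ.source ∧ Φ.source ⊆ U ∧
      ContDiffOn ℝ ∞ Φ.symm Φ.target ∧ ∀ x, Φ x = f x := by
  have hfa : ContDiffAt ℝ ∞ f x₀ := hf.contDiffAt (hU.mem_nhds hx₀)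
  have hid' : HasFDerivAt f ((ContinuousLinearEquiv.refl ℝ X : X ≃L[ℝ] X) : X →L[ℝ] X) x₀ := hid
  set Ψ := hfa.toOpenPartialHomeomorph f hid' (by simp) with hΨ
  have hcont : ContinuousOn (fderiv ℝ f) U := hf.continuousOn_fderiv_of_isOpen hU (by simp)
  set W : Set X := U ∩ fderiv ℝ f ⁻¹' range ((↑) : (X ≃L[ℝ] X) → X →L[ℝ] X) with hW
  have hWo : IsOpen W := hcont.isOpen_inter_preimage hU ContinuousLinearEquiv.isOpen
  have hxW : x₀ ∈ W := ⟨hx₀, ContinuousLinearEquiv.refl ℝ X, hid'.fderiv.symm⟩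
  refine ⟨Ψ.restrOpen W hWo, ⟨hfa.mem_toOpenPartialHomeomorph_source hid' (by simp), hxW⟩,
    fun x hx => hx.2.1, fun y hy => ?_, fun x => rfl⟩
  have hy1 : y ∈ Ψ.target := hy.1
  have hy2 : Ψ.symm y ∈ W := hy.2
  obtain ⟨e, he⟩ := hy2.2
  have hfy : ContDiffAt ℝ ∞ f (Ψ.symm y) := hf.contDiffAt (hU.mem_nhds hy2.1)
  refine ContDiffAt.contDiffWithinAt (f := Ψ.symm) ?_
  refine Ψ.contDiffAt_symm (f₀' := e) hy1 ?_ hfy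
  rw [he]
  exact (hfy.differentiableAt (by simp)).hasFDerivAt

/-- A submersion becomes linear in suitable coordinates of its source. -/
theorem exists_straightening [CompleteSpace X] [FiniteDimensional ℝ V] {h : X → V} {U : Set X}
    (hU : IsOpen U) (hh : ContDiffOn ℝ ∞ h U) {x₀ : X} (hx₀ : x₀ ∈ U)
    (hs : Function.Surjective (fderiv ℝ h x₀)) :
    ∃ Φ : OpenPartialHomeomorph X X, x₀ ∈ Φ.source ∧ Φ.source ⊆ U ∧
      ContDiffOn ℝ ∞ Φ.symm Φ.target ∧ ∀ x, h x = fderiv ℝ h x₀ (Φ x) := by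
  set A := fderiv ℝ h x₀ with hA
  obtain ⟨R, hR⟩ := ContinuousLinearMap.exists_rightInverse_of_surjective A
    (LinearMap.range_eq_top.2 hs)
  have hAR : ∀ v, A (R v) = v := fun v => by simpa using congrArg (fun L => L v) hR
  obtain ⟨Φ, h1, h2, h3, h4⟩ := exists_openPartialHomeomorph_of_fderiv_eq_id
    (f := fun x => R (h x) + (x - R (A x))) hU (by fun_prop) hx₀ (by
      have hd : HasFDerivAt h A x₀ :=
        ((hh.contDiffAt (hU.mem_nhds hx₀)).differentiableAt (by simp)).hasFDerivAt
      have := (R.hasFDerivAt.comp x₀ hd).add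
        ((hasFDerivAt_id x₀).sub (R.hasFDerivAt.comp x₀ A.hasFDerivAt))
      convert! this using 1
      ext x; simp)
  refine ⟨Φ, h1, h2, h3, fun x => ?_⟩
  rw [h4]
  simp [hAR]

theorem exists_localSection_of_surjective_fderiv [CompleteSpace X] [FiniteDimensional ℝ V]
    {h : X → V} {U : Set X} (hU : IsOpen U) (hh : ContDiffOn ℝ ∞ h U) {x₀ : X} (hx₀ : x₀ ∈ U)
    (hs : Function.Surjective (fderiv ℝ h x₀)) :
    ∃ (B : Set V) (s : V → X), IsOpen B ∧ h x₀ ∈ B ∧ ContDiffOn ℝ ∞ s B ∧ MapsTo s B U ∧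
      (∀ v ∈ B, h (s v) = v) ∧ s (h x₀) = x₀ := by
  obtain ⟨Φ, h1, h2, h3, h4⟩ := exists_straightening hU hh hx₀ hs
  set A := fderiv ℝ h x₀ with hA
  obtain ⟨R, hR⟩ := ContinuousLinearMap.exists_rightInverse_of_surjective A
    (LinearMap.range_eq_top.2 hs)
  have hAR : ∀ v, A (R v) = v := fun v => by simpa using congrArg (fun L => L v) hR
  set k : V → X := fun v => Φ x₀ + R (v - h x₀) with hk
  have hkc : ContDiff ℝ ∞ k := by fun_prop
  refine ⟨k ⁻¹' Φ.target, Φ.symm ∘ k, Φ.open_target.preimage hkc.continuous, ?_,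
    h3.comp hkc.contDiffOn fun v hv => hv, fun v hv => h2 (Φ.map_target hv), fun v hv => ?_, ?_⟩
  · simpa [hk] using Φ.map_source h1
  · simp only [Function.comp_apply]
    rw [h4, Φ.right_inv hv]
    simp [hk, hAR, ← h4]
  · simp [hk, Φ.left_inv h1]

/-- The constant rank theorem: if the rank of `dF` is at most `dim V` near `x₀` and `P ∘ F` is a
submersion to `V`, then `F` factors locally through `P ∘ F`. -/
theorem eventually_eq_of_finrank_range_fderiv_le [CompleteSpace X] [FiniteDimensional ℝ X]
    [FiniteDimensional ℝ V]
    {F : X → E} {U : Set X} (hU : IsOpen U) (hF : ContDiffOn ℝ ∞ F U) {x₀ : X} (hx₀ : x₀ ∈ U)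
    (hrank : ∀ x ∈ U, Module.finrank ℝ (fderiv ℝ F x).range ≤ Module.finrank ℝ V)
    (P : E →L[ℝ] V) (hs : Function.Surjective (P ∘L fderiv ℝ F x₀)) :
    ∃ W : Set X, IsOpen W ∧ x₀ ∈ W ∧ W ⊆ U ∧
      ∀ x ∈ W, ∀ y ∈ W, P (F x) = P (F y) → F x = F y := by
  have hFd : ∀ x ∈ U, HasFDerivAt F (fderiv ℝ F x) x := fun x hx =>
    ((hF.contDiffAt (hU.mem_nhds hx)).differentiableAt (by simp)).hasFDerivAt
  have hder : fderiv ℝ (fun x => P (F x)) x₀ = P ∘L fderiv ℝ F x₀ :=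
    (P.hasFDerivAt.comp x₀ (hFd x₀ hx₀)).fderiv
  obtain ⟨Φ, h1, h2, h3, h4⟩ := exists_straightening (h := fun x => P (F x)) hU
    (P.contDiff.comp_contDiffOn hF) hx₀ (by rw [hder]; exact hs)
  rw [hder] at h4
  set A := P ∘L fderiv ℝ F x₀ with hA
  obtain ⟨ε, hε, hball⟩ := Metric.isOpen_iff.1 Φ.open_target (Φ x₀) (Φ.map_source h1)
  refine ⟨Φ.source ∩ Φ ⁻¹' Metric.ball (Φ x₀) ε,
    Φ.isOpen_inter_preimage Metric.isOpen_ball, ⟨h1, Metric.mem_ball_self hε⟩,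
    fun x hx => h2 hx.1, fun x hx y hy hxy => ?_⟩
  have hAxy : A (Φ y - Φ x) = 0 := by rw [map_sub, ← h4, ← h4, hxy, sub_self]
  set γ : ℝ → X := fun t => Φ x + t • (Φ y - Φ x) with hγ
  have hγmem : ∀ t ∈ Icc (0 : ℝ) 1, γ t ∈ Φ.target := fun t ht => by
    apply hball
    have := (convex_ball (Φ x₀) ε).add_smul_sub_mem hx.2 hy.2 ht
    exact this
  have hderiv : ∀ t ∈ Icc (0 : ℝ) 1, HasDerivAt (fun t => F (Φ.symm (γ t))) 0 t := by
    intro t ht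
    have hz := hγmem t ht
    set z := γ t with hz'
    have hzU : Φ.symm z ∈ U := h2 (Φ.map_target hz)
    have hsd : HasFDerivAt Φ.symm (fderiv ℝ Φ.symm z) z :=
      ((h3.contDiffAt (Φ.open_target.mem_nhds hz)).differentiableAt (by simp)).hasFDerivAt
    set D := fderiv ℝ F (Φ.symm z) with hD
    set S := fderiv ℝ Φ.symm z with hS
    have hcomp : HasFDerivAt (fun z => F (Φ.symm z)) (D ∘L S) z := (hFd _ hzU).comp z hsd
    have hPA : P ∘L (D ∘L S) = A := by
      have e1 : HasFDerivAt (fun z => P (F (Φ.symm z))) (P ∘L (D ∘L S)) z :=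
        P.hasFDerivAt.comp z hcomp
      have e2 : (fun z => P (F (Φ.symm z))) =ᶠ[𝓝 z] A := by
        filter_upwards [Φ.open_target.mem_nhds hz] with w hw
        rw [h4, Φ.right_inv hw]
      exact e1.unique (A.hasFDerivAt.congr_of_eventuallyEq e2)
    have hw : (D ∘L S) (Φ y - Φ x) = 0 := by
      have hsurj : Function.Surjective ((P : E →ₗ[ℝ] V).domRestrict D.range) := by
        intro v
        obtain ⟨u, hu⟩ := hs v
        refine ⟨⟨D (S u), LinearMap.mem_range_self _ _⟩, ?_⟩
        have : (P ∘L (D ∘L S)) u = v := by rw [hPA]; exact hu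
        exact this
      have hinj : Function.Injective ((P : E →ₗ[ℝ] V).domRestrict D.range) := by
        have hle : Module.finrank ℝ D.range ≤ Module.finrank ℝ V := hrank _ hzU
        have := LinearMap.finrank_range_add_finrank_ker
          ((P : E →ₗ[ℝ] V).domRestrict D.range)
        rw [LinearMap.range_eq_top.2 hsurj, finrank_top] at this
        rw [← LinearMap.ker_eq_bot, ← Submodule.finrank_eq_zero]
        omega
      have hker : ((P : E →ₗ[ℝ] V).domRestrict D.range)
          ⟨D (S (Φ y - Φ x)), LinearMap.mem_range_self _ _⟩ = 0 := by
        have : (P ∘L (D ∘L S)) (Φ y - Φ x) = 0 := by rw [hPA]; exact hAxy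
        exact this
      have := hinj (hker.trans (map_zero _).symm)
      exact congrArg Subtype.val this
    have hγd : HasDerivAt γ (Φ y - Φ x) t := by
      have := ((hasDerivAt_id t).smul_const (Φ y - Φ x)).const_add (Φ x)
      rw [one_smul] at this
      exact this
    have := hcomp.comp_hasDerivAt t hγd
    rw [hw] at this
    exact this
  have hconst := constant_of_has_deriv_right_zero
    (fun t ht => (hderiv t ht).continuousAt.continuousWithinAt)
    (fun t ht => (hderiv t (Ico_subset_Icc_self ht)).hasDerivWithinAt) 1 (by simp)
  have e0 : γ 0 = Φ x := by simp [hγ]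
  have e1 : γ 1 = Φ y := by simp [hγ]
  simp only [e0, e1, Φ.left_inv hx.1, Φ.left_inv hy.1] at hconst
  exact hconst.symm

open VectorField in
/-- The Lie bracket is natural for related vector fields. -/
theorem fderiv_lieBracket_of_related {f : X → E} {x₀ : X} (hf : ContDiffAt ℝ 2 f x₀)
    {V W : X → X} {V' W' : E → E} (hV : DifferentiableAt ℝ V x₀) (hW : DifferentiableAt ℝ W x₀)
    (hV' : DifferentiableAt ℝ V' (f x₀)) (hW' : DifferentiableAt ℝ W' (f x₀))
    (hVV' : ∀ᶠ x in 𝓝 x₀, fderiv ℝ f x (V x) = V' (f x))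
    (hWW' : ∀ᶠ x in 𝓝 x₀, fderiv ℝ f x (W x) = W' (f x)) :
    fderiv ℝ f x₀ (lieBracket ℝ V W x₀) = lieBracket ℝ V' W' (f x₀) := by
  have hfd : DifferentiableAt ℝ f x₀ := hf.differentiableAt (by simp)
  rw [fderiv_apply_lieBracket hf (by simp) hW hV]
  have e1 : (fun x => fderiv ℝ f x (W x)) =ᶠ[𝓝 x₀] W' ∘ f := hWW'
  have e2 : (fun x => fderiv ℝ f x (V x)) =ᶠ[𝓝 x₀] V' ∘ f := hVV'
  rw [e1.fderiv_eq, e2.fderiv_eq, fderiv_comp x₀ hW' hfd, fderiv_comp x₀ hV' hfd]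
  simp [lieBracket, hVV'.self_of_nhds, hWW'.self_of_nhds]

/-- A vector field tangent to an immersion lifts to the source of the immersion. -/
theorem exists_differentiableAt_lift [CompleteSpace X] [FiniteDimensional ℝ E]
    {f : X → E} {x₀ : X} (hf : ContDiffAt ℝ 2 f x₀)
    (hinj : Function.Injective (fderiv ℝ f x₀)) {Y : X → E} (hY : DifferentiableAt ℝ Y x₀)
    (hYr : ∀ᶠ x in 𝓝 x₀, Y x ∈ (fderiv ℝ f x).range) :
    ∃ V : X → X, DifferentiableAt ℝ V x₀ ∧ ∀ᶠ x in 𝓝 x₀, fderiv ℝ f x (V x) = Y x := by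
  obtain ⟨Q', hQ'⟩ := (fderiv ℝ f x₀).toLinearMap.exists_leftInverse_of_injective
    (LinearMap.ker_eq_bot.2 hinj)
  set Q : E →L[ℝ] X := LinearMap.toContinuousLinearMap Q' with hQ
  have hQid : Q ∘L fderiv ℝ f x₀ = ContinuousLinearMap.id ℝ X := by
    ext v
    exact congrArg (fun L => L v) hQ'
  set B : X → X →L[ℝ] X := fun x => Q ∘L fderiv ℝ f x with hB
  have hfd : DifferentiableAt ℝ (fderiv ℝ f) x₀ :=
    (hf.fderiv_right (m := 1) (by norm_num)).differentiableAt (by simp)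
  have hBd : DifferentiableAt ℝ B x₀ := (differentiableAt_const Q).clm_comp hfd
  have hB0 : B x₀ = ((ContinuousLinearEquiv.refl ℝ X : X ≃L[ℝ] X) : X →L[ℝ] X) := hQid
  have hinv : ∀ᶠ x in 𝓝 x₀, B x ∈ range ((↑) : (X ≃L[ℝ] X) → X →L[ℝ] X) :=
    hBd.continuousAt.eventually_mem
      (ContinuousLinearEquiv.isOpen.mem_nhds (by rw [hB0]; exact mem_range_self _))
  have hBinv : DifferentiableAt ℝ (fun x => (B x).inverse) x₀ := by
    have h1 : DifferentiableAt ℝ (ContinuousLinearMap.inverse : (X →L[ℝ] X) → X →L[ℝ] X)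
        (B x₀) := by
      rw [hB0]
      exact (contDiffAt_map_inverse (n := 1) _).differentiableAt (by simp)
    exact h1.comp x₀ hBd
  refine ⟨fun x => (B x).inverse (Q (Y x)),
    hBinv.clm_apply (Q.differentiableAt.comp x₀ hY), ?_⟩
  filter_upwards [hinv, hYr] with x ⟨e, he⟩ ⟨u, hu⟩
  have h1 : Q (Y x) = e u := by
    have : B x u = e u := by rw [← he]; rfl
    rw [← this, ← hu]
    rfl
  rw [h1, ← he, ContinuousLinearMap.inverse_equiv]
  simpa using hu

end Calculus

end GManifold

namespace GManifold

theorem finrank_range_le_of_eq_comp {E₁ E₂ E₃ E₄ : Type*} [AddCommGroup E₁] [Module ℝ E₁]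
    [AddCommGroup E₂] [Module ℝ E₂] [AddCommGroup E₃] [Module ℝ E₃] [AddCommGroup E₄] [Module ℝ E₄]
    [FiniteDimensional ℝ E₃] {D : E₁ →ₗ[ℝ] E₄} (A : E₃ →ₗ[ℝ] E₄) (B : E₂ →ₗ[ℝ] E₃)
    (C : E₁ →ₗ[ℝ] E₂) (h : ∀ v, D v = A (B (C v))) :
    Module.finrank ℝ (LinearMap.range D) ≤ Module.finrank ℝ (LinearMap.range B) := by
  refine le_trans (Submodule.finrank_mono (t := (LinearMap.range B).map A) ?_)
    (Submodule.finrank_map_le A _)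
  rintro _ ⟨v, rfl⟩
  exact ⟨B (C v), LinearMap.mem_range_self _ _, (h v).symm⟩

section ManifoldCalculus

variable {E : Type*} [NormedAddCommGroup E] [NormedSpace ℝ E]
  {H : Type*} [TopologicalSpace H] {I : ModelWithCorners ℝ E H} [I.Boundaryless]
  {X : Type*} [TopologicalSpace X] [ChartedSpace H X] [IsManifold I ∞ X]
  {E' : Type*} [NormedAddCommGroup E'] [NormedSpace ℝ E']
  {H' : Type*} [TopologicalSpace H'] {I' : ModelWithCorners ℝ E' H'} [I'.Boundaryless]
  {M : Type*} [TopologicalSpace M] [ChartedSpace H' M] [IsManifold I' ∞ M]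

instance instFiniteDimensionalTangentSpace [FiniteDimensional ℝ E] (x : X) :
    FiniteDimensional ℝ (TangentSpace I x) :=
  inferInstanceAs (FiniteDimensional ℝ E)

theorem mdifferentiableAt_extChartAt_symm {x : X} {z : E} (hz : z ∈ (extChartAt I x).target) :
    MDifferentiableAt 𝓘(ℝ, E) I (extChartAt I x).symm z := by
  have : IsManifold I 1 X := IsManifold.of_le (n := ∞) (by simp)
  have := mdifferentiableWithinAt_extChartAt_symm hz
  rwa [I.range_eq_univ, mdifferentiableWithinAt_univ] at this

theorem hasFDerivAt_writtenInExtChartAt {F : X → M} {x₀ : X} {z : E}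
    (hz : z ∈ (extChartAt I x₀).target)
    (hFz : F ((extChartAt I x₀).symm z) ∈ (extChartAt I' (F x₀)).source)
    (hF : MDifferentiableAt I I' F ((extChartAt I x₀).symm z)) :
    HasFDerivAt (writtenInExtChartAt I I' x₀ F)
      ((mfderiv I' 𝓘(ℝ, E') (extChartAt I' (F x₀)) (F ((extChartAt I x₀).symm z))) ∘L
        (mfderiv I I' F ((extChartAt I x₀).symm z) ∘L
          mfderiv 𝓘(ℝ, E) I (extChartAt I x₀).symm z) : E →L[ℝ] E') z := by
  have : IsManifold I' 1 M := IsManifold.of_le (n := ∞) (by simp)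
  have h1 := (mdifferentiableAt_extChartAt_symm hz).hasMFDerivAt
  have h2 := hF.hasMFDerivAt
  have h3 := (mdifferentiableAt_extChartAt (I := I') (x := F x₀)
    (by rwa [extChartAt_source] at hFz)).hasMFDerivAt
  exact (h3.comp z (h2.comp z h1)).hasFDerivAt

theorem fderiv_writtenInExtChartAt_self {F : X → M} {x₀ : X} (hF : MDifferentiableAt I I' F x₀) :
    fderiv ℝ (writtenInExtChartAt I I' x₀ F) (extChartAt I x₀ x₀) = mfderiv I I' F x₀ := by
  rw [hF.mfderiv, I.range_eq_univ, fderivWithin_univ]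

theorem contDiffOn_writtenInExtChartAt {F : X → M} {U : Set X} (hU : IsOpen U)
    (hF : ContMDiffOn I I' ∞ F U) (x₀ : X) :
    IsOpen ((extChartAt I x₀).target ∩ (extChartAt I x₀).symm ⁻¹'
        (U ∩ F ⁻¹' (extChartAt I' (F x₀)).source)) ∧
      ContDiffOn ℝ ∞ (writtenInExtChartAt I I' x₀ F)
        ((extChartAt I x₀).target ∩ (extChartAt I x₀).symm ⁻¹'
          (U ∩ F ⁻¹' (extChartAt I' (F x₀)).source)) := by
  constructor
  · exact (continuousOn_extChartAt_symm x₀).isOpen_inter_preimage (isOpen_extChartAt_target x₀)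
      (hF.continuousOn.isOpen_inter_preimage hU (isOpen_extChartAt_source _))
  · rw [← contMDiffOn_iff_contDiffOn]
    exact (contMDiffOn_extChartAt (I := I') (x := F x₀)).comp
      (hF.comp ((contMDiffOn_extChartAt_symm x₀).mono inter_subset_left) fun z hz => hz.2.1)
      fun z hz => by
        have := hz.2.2
        rw [extChartAt_source] at this
        exact this

theorem exists_localSection_of_surjective_mfderiv [CompleteSpace E] {V : Type*}
    [NormedAddCommGroup V] [NormedSpace ℝ V] [FiniteDimensional ℝ V] {h : X → V} {U : Set X}
    (hU : IsOpen U) (hh : ContMDiffOn I 𝓘(ℝ, V) ∞ h U) {x₀ : X} (hx₀ : x₀ ∈ U)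
    (hs : Function.Surjective (mfderiv I 𝓘(ℝ, V) h x₀)) :
    ∃ (B : Set V) (s : V → X), IsOpen B ∧ h x₀ ∈ B ∧ ContMDiffOn 𝓘(ℝ, V) I ∞ s B ∧
      MapsTo s B U ∧ (∀ v ∈ B, h (s v) = v) ∧ s (h x₀) = x₀ := by
  set e := extChartAt I x₀ with he
  obtain ⟨hO, hC⟩ := contDiffOn_writtenInExtChartAt hU hh x₀
  have hd : MDifferentiableAt I 𝓘(ℝ, V) h x₀ :=
    (hh.contMDiffAt (hU.mem_nhds hx₀)).mdifferentiableAt (by simp)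
  have hwr : writtenInExtChartAt I 𝓘(ℝ, V) x₀ h = h ∘ e.symm := rfl
  obtain ⟨B, s, hB, h0, h1, h2, h3, h4⟩ := exists_localSection_of_surjective_fderiv hO hC
    (x₀ := e x₀) (by simp [he, hx₀]) (by rw [fderiv_writtenInExtChartAt_self hd]; exact hs)
  have hx : (h ∘ e.symm) (e x₀) = h x₀ := by simp [he]
  rw [hwr] at h0 h3 h4
  rw [hx] at h0 h4
  refine ⟨B, e.symm ∘ s, hB, h0, ?_, fun v hv => (h2 hv).2.1, h3, ?_⟩
  · exact (contMDiffOn_extChartAt_symm x₀).comp h1.contMDiffOn fun v hv => (h2 hv).1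
  · simp [h4, he]

/-- Local section of a submersion between manifolds. -/
theorem exists_contMDiffAt_localSection [CompleteSpace E] [FiniteDimensional ℝ E'] {f : X → M}
    (hf : ContMDiff I I' ∞ f) (x₀ : X) (hs : Function.Surjective (mfderiv I I' f x₀)) :
    ∃ s : M → X, ContMDiffAt I' I ∞ s (f x₀) ∧ s (f x₀) = x₀ ∧ ∀ᶠ y in 𝓝 (f x₀), f (s y) = y := by
  have : IsManifold I' 1 M := IsManifold.of_le (n := ∞) (by simp)
  set e := extChartAt I' (f x₀) with he
  have hd := hf.mdifferentiableAt (by simp) (x := x₀)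
  have hU : IsOpen (f ⁻¹' e.source) := (isOpen_extChartAt_source _).preimage hf.continuous
  have hce : ContMDiffOn I' 𝓘(ℝ, E') ∞ e e.source := by
    simpa only [he, extChartAt_source] using contMDiffOn_extChartAt (I := I') (x := f x₀)
  have hder : mfderiv I 𝓘(ℝ, E') (e ∘ f) x₀ = mfderiv I I' f x₀ := by
    rw [mfderiv_comp x₀ (mdifferentiableAt_extChartAt (mem_chart_source _ _)) hd,
      mfderiv_extChartAt_self]
    rfl
  obtain ⟨B, s, hB, h0, h1, h2, h3, h4⟩ := exists_localSection_of_surjective_mfderiv hU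
    (h := e ∘ f) (hce.comp hf.contMDiffOn fun x hx => hx) (x₀ := x₀)
    (mem_extChartAt_source (I := I') (f x₀)) (by rw [hder]; exact hs)
  have hes : ContMDiffAt I' 𝓘(ℝ, E') ∞ e (f x₀) := contMDiffAt_extChartAt
  refine ⟨s ∘ e, (h1.contMDiffAt (hB.mem_nhds h0)).comp (f x₀) hes, h4, ?_⟩
  filter_upwards [hes.continuousAt.preimage_mem_nhds (hB.mem_nhds h0),
    extChartAt_source_mem_nhds (I := I') (f x₀)] with y hy hy'
  exact e.injOn (h2 hy) hy' (h3 _ hy)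

theorem exists_continuousLinearMap_comp_surjective {E₁ E₂ : Type*} [AddCommGroup E₁] [Module ℝ E₁]
    [NormedAddCommGroup E₂] [NormedSpace ℝ E₂] [FiniteDimensional ℝ E₂] (T : E₁ →ₗ[ℝ] E₂) {n : ℕ}
    (hn : Module.finrank ℝ (LinearMap.range T) = n) :
    ∃ L : E₂ →L[ℝ] EuclideanSpace ℝ (Fin n), Function.Surjective (fun v => L (T v)) := by
  obtain ⟨π, hπ⟩ := (LinearMap.range T).subtype.exists_leftInverse_of_injective
    (Submodule.ker_subtype _)
  have e : LinearMap.range T ≃ₗ[ℝ] EuclideanSpace ℝ (Fin n) :=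
    LinearEquiv.ofFinrankEq _ _ (by simp [hn])
  refine ⟨LinearMap.toContinuousLinearMap (e.toLinearMap ∘ₗ π), fun w => ?_⟩
  obtain ⟨v, hv⟩ := (e.symm w).2
  refine ⟨v, ?_⟩
  have : π (T v) = e.symm w := by
    rw [hv]
    exact congrArg (fun L => L (e.symm w)) hπ
  simp [this]

/-- The constant rank theorem for maps between manifolds: if the rank of `dF` is at most `n`, with
equality at `x₀`, then near `x₀` the fibres of `F` are those of a submersion `h ∘ F` to `ℝⁿ`. -/
theorem exists_submersion_of_finrank_range_mfderiv_le [FiniteDimensional ℝ E]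
    [FiniteDimensional ℝ E'] {F : X → M} (hF : ContMDiff I I' ∞ F) (x₀ : X) {n : ℕ}
    (hn : Module.finrank ℝ (mfderiv I I' F x₀).range = n)
    (hle : ∀ x, Module.finrank ℝ (mfderiv I I' F x).range ≤ n) :
    ∃ (h : M → EuclideanSpace ℝ (Fin n)) (W : Set M) (U : Set X), IsOpen W ∧ F x₀ ∈ W ∧
      ContMDiffOn I' (𝓡 n) ∞ h W ∧ IsOpen U ∧ x₀ ∈ U ∧ U ⊆ F ⁻¹' W ∧
      Function.Surjective (fun v => mfderiv I' (𝓡 n) h (F x₀) (mfderiv I I' F x₀ v)) ∧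
      ∀ x ∈ U, ∀ y ∈ U, h (F x) = h (F y) → F x = F y := by
  have : IsManifold I' 1 M := IsManifold.of_le (n := ∞) (by simp)
  set e := extChartAt I x₀ with he
  set e' := extChartAt I' (F x₀) with he'
  obtain ⟨hO, hC⟩ := contDiffOn_writtenInExtChartAt isOpen_univ hF.contMDiffOn x₀
  have hd : ∀ x, MDifferentiableAt I I' F x := fun x => hF.mdifferentiableAt (by simp)
  have hself := fderiv_writtenInExtChartAt_self (hd x₀)
  set F' := writtenInExtChartAt I I' x₀ F with hF'
  obtain ⟨L, hL⟩ := exists_continuousLinearMap_comp_surjective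
    (E₂ := E') (mfderiv I I' F x₀).toLinearMap hn
  obtain ⟨W, hW, hxW, hWU, hWF⟩ := eventually_eq_of_finrank_range_fderiv_le hO hC
    (x₀ := e x₀) (by simp [he]) (V := EuclideanSpace ℝ (Fin n)) (fun z hz => by
      rw [(hasFDerivAt_writtenInExtChartAt hz.1 hz.2.2 (hd _)).fderiv]
      simp only [finrank_euclideanSpace, Fintype.card_fin]
      refine le_trans ?_ (hle (e.symm z))
      exact finrank_range_le_of_eq_comp _ _ _ fun v => rfl) L (by rw [hself]; exact hL)
  refine ⟨L ∘ e', e'.source, e.source ∩ e ⁻¹' W ∩ F ⁻¹' e'.source,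
    isOpen_extChartAt_source _, mem_extChartAt_source _, ?_, ?_, ?_, fun x hx => hx.2, ?_, ?_⟩
  · refine L.contMDiff.comp_contMDiffOn ?_
    simpa only [he', extChartAt_source] using contMDiffOn_extChartAt (I := I') (x := F x₀)
  · exact ((isOpen_extChartAt_preimage' x₀ hW)).inter
      ((isOpen_extChartAt_source _).preimage hF.continuous)
  · exact ⟨⟨mem_extChartAt_source _, hxW⟩, mem_extChartAt_source _⟩
  · have : mfderiv I' (𝓡 n) (L ∘ e') (F x₀) = L := by
      rw [mfderiv_comp (I' := 𝓘(ℝ, E')) (F x₀) L.mdifferentiableAt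
        (mdifferentiableAt_extChartAt (mem_chart_source _ _)),
        mfderiv_extChartAt_self, L.mfderiv_eq]
      rfl
    rw [this]
    exact hL
  · intro x hx y hy hxy
    have hFx : F' (e x) = e' (F x) := by
      change e' (F (e.symm (e x))) = _
      rw [e.left_inv hx.1.1]
    have hFy : F' (e y) = e' (F y) := by
      change e' (F (e.symm (e y))) = _
      rw [e.left_inv hy.1.1]
    have := hWF (e x) hx.1.2 (e y) hy.1.2 (by rw [hFx, hFy]; exact hxy)
    rw [hFx, hFy] at this
    exact e'.injOn hx.2 hy.2 this

end ManifoldCalculus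

end GManifold

namespace GManifold

section Brackets

open VectorField

variable {E : Type*} [NormedAddCommGroup E] [NormedSpace ℝ E] [CompleteSpace E]
  {H : Type*} [TopologicalSpace H] {I : ModelWithCorners ℝ E H} [I.Boundaryless]
  {X : Type*} [TopologicalSpace X] [ChartedSpace H X] [IsManifold I ∞ X]
  {E' : Type*} [NormedAddCommGroup E'] [NormedSpace ℝ E'] [CompleteSpace E']
  {H' : Type*} [TopologicalSpace H'] {I' : ModelWithCorners ℝ E' H'} [I'.Boundaryless]
  {M : Type*} [TopologicalSpace M] [ChartedSpace H' M] [IsManifold I' ∞ M]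

/-- A vector field read in the chart at `x₀`. -/
def chartField (V : (x : X) → TangentSpace I x) (x₀ : X) : E → E :=
  mpullbackWithin 𝓘(ℝ, E) I (extChartAt I x₀).symm V (range I)

theorem mfderiv_extChartAt_symm_inverse_apply {x₀ : X} {z : E}
    (hz : z ∈ (extChartAt I x₀).target) (u : TangentSpace I ((extChartAt I x₀).symm z)) :
    (mfderiv 𝓘(ℝ, E) I (extChartAt I x₀).symm z).inverse u =
      mfderiv I 𝓘(ℝ, E) (extChartAt I x₀) ((extChartAt I x₀).symm z) u := by
  have : IsManifold I 1 X := IsManifold.of_le (n := ∞) (by simp)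
  have h1 := mfderivWithin_extChartAt_symm_comp_mfderiv_extChartAt hz
  have h2 := mfderiv_extChartAt_comp_mfderivWithin_extChartAt_symm hz
  rw [I.range_eq_univ, mfderivWithin_univ] at h1 h2
  rw [ContinuousLinearMap.inverse_eq h1 h2]
  rfl

theorem chartField_apply (V : (x : X) → TangentSpace I x) {x₀ : X} {z : E}
    (hz : z ∈ (extChartAt I x₀).target) :
    chartField V x₀ z = mfderiv I 𝓘(ℝ, E) (extChartAt I x₀) ((extChartAt I x₀).symm z)
      (V ((extChartAt I x₀).symm z)) := by
  rw [← mfderiv_extChartAt_symm_inverse_apply hz, chartField, mpullbackWithin_apply,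
    I.range_eq_univ, mfderivWithin_univ]

theorem chartField_extChartAt (V : (x : X) → TangentSpace I x) {x₀ x : X}
    (hx : x ∈ (extChartAt I x₀).source) :
    chartField V x₀ (extChartAt I x₀ x) = mfderiv I 𝓘(ℝ, E) (extChartAt I x₀) x (V x) := by
  rw [chartField_apply V ((extChartAt I x₀).map_source hx), (extChartAt I x₀).left_inv hx]

theorem differentiableAt_chartField {V : (x : X) → TangentSpace I x} {x₀ : X}
    (hV : MDifferentiableAt I I.tangent (fun x => (⟨x, V x⟩ : TangentBundle I X)) x₀) :
    DifferentiableAt ℝ (chartField V x₀) (extChartAt I x₀ x₀) := by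
  have : IsManifold I 2 X := IsManifold.of_le (n := ∞) ENat.LEInfty.out
  have := MDifferentiableWithinAt.differentiableWithinAt_mpullbackWithin_vectorField
    (s := univ) hV.mdifferentiableWithinAt
  rw [preimage_univ, univ_inter, I.range_eq_univ] at this
  rw [chartField, I.range_eq_univ]
  exact differentiableWithinAt_univ.1 this

theorem mlieBracket_eq_lieBracket_chartField (V W : (x : X) → TangentSpace I x) (x₀ : X) :
    mlieBracket I V W x₀ =
      lieBracket ℝ (chartField V x₀) (chartField W x₀) (extChartAt I x₀ x₀) := by
  have : IsManifold I 1 X := IsManifold.of_le (n := ∞) (by simp)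
  have h : ∀ A : E →L[ℝ] E, A = ContinuousLinearMap.id ℝ E → ∀ v, A.inverse v = v := by
    rintro _ rfl v
    rw [ContinuousLinearMap.inverse_id]
    rfl
  have h1 := h _ (mfderiv_extChartAt_self (I := I) (x := x₀))
    (lieBracketWithin ℝ (chartField V x₀) (chartField W x₀)
      ((extChartAt I x₀).symm ⁻¹' univ ∩ range I) (extChartAt I x₀ x₀))
  refine Eq.trans h1 ?_
  rw [preimage_univ, univ_inter, I.range_eq_univ, lieBracketWithin_univ]

theorem eventually_mem_chart_domains {f : X → M} {x₀ : X} (hf : ContinuousAt f x₀) :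
    ∀ᶠ z in 𝓝 (extChartAt I x₀ x₀), z ∈ (extChartAt I x₀).target ∧
      f ((extChartAt I x₀).symm z) ∈ (extChartAt I' (f x₀)).source := by
  refine Filter.inter_mem (extChartAt_target_mem_nhds x₀) ?_
  have h1 := continuousAt_extChartAt_symm (I := I) x₀
  have h2 : ContinuousAt f ((extChartAt I x₀).symm (extChartAt I x₀ x₀)) := by
    rwa [extChartAt_to_inv]
  refine (h2.comp h1).preimage_mem_nhds ?_
  simp only [Function.comp_apply, extChartAt_to_inv]
  exact extChartAt_source_mem_nhds _

theorem fderiv_writtenInExtChartAt_apply {f : X → M} {x₀ : X} {z : E}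
    (hz : z ∈ (extChartAt I x₀).target)
    (hfz : f ((extChartAt I x₀).symm z) ∈ (extChartAt I' (f x₀)).source)
    (hf : MDifferentiableAt I I' f ((extChartAt I x₀).symm z))
    {u : TangentSpace I ((extChartAt I x₀).symm z)} {W : (y : M) → TangentSpace I' y}
    (hu : mfderiv I I' f ((extChartAt I x₀).symm z) u = W (f ((extChartAt I x₀).symm z))) :
    fderiv ℝ (writtenInExtChartAt I I' x₀ f) z
        (mfderiv I 𝓘(ℝ, E) (extChartAt I x₀) ((extChartAt I x₀).symm z) u) =
      chartField W (f x₀) (writtenInExtChartAt I I' x₀ f z) := by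
  have : IsManifold I 1 X := IsManifold.of_le (n := ∞) (by simp)
  have h1 : writtenInExtChartAt I I' x₀ f z =
    extChartAt I' (f x₀) (f ((extChartAt I x₀).symm z)) := rfl
  rw [(hasFDerivAt_writtenInExtChartAt hz hfz hf).fderiv, h1, chartField_extChartAt W hfz, ← hu]
  have h2 := mfderivWithin_extChartAt_symm_comp_mfderiv_extChartAt hz
  rw [I.range_eq_univ, mfderivWithin_univ] at h2
  have h3 := congrArg (fun L => L u) h2
  exact congrArg (fun w => mfderiv I' 𝓘(ℝ, E') (extChartAt I' (f x₀)) _ (mfderiv I I' f _ w)) h3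

/-- The Lie bracket is natural for related vector fields. -/
theorem mfderiv_mlieBracket_of_related {f : X → M} (hf : ContMDiff I I' ∞ f) (x₀ : X)
    {V W : (x : X) → TangentSpace I x} {V' W' : (y : M) → TangentSpace I' y}
    (hV : MDifferentiableAt I I.tangent (fun x => (⟨x, V x⟩ : TangentBundle I X)) x₀)
    (hW : MDifferentiableAt I I.tangent (fun x => (⟨x, W x⟩ : TangentBundle I X)) x₀)
    (hV' : MDifferentiableAt I' I'.tangent (fun x => (⟨x, V' x⟩ : TangentBundle I' M)) (f x₀))
    (hW' : MDifferentiableAt I' I'.tangent (fun x => (⟨x, W' x⟩ : TangentBundle I' M)) (f x₀))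
    (hVV' : ∀ x, mfderiv I I' f x (V x) = V' (f x))
    (hWW' : ∀ x, mfderiv I I' f x (W x) = W' (f x)) :
    mfderiv I I' f x₀ (mlieBracket I V W x₀) = mlieBracket I' V' W' (f x₀) := by
  have hd : ∀ x, MDifferentiableAt I I' f x := fun x => hf.mdifferentiableAt (by simp)
  have hfx : writtenInExtChartAt I I' x₀ f (extChartAt I x₀ x₀) = extChartAt I' (f x₀) (f x₀) := by
    simp [writtenInExtChartAt]
  obtain ⟨hO, hC⟩ := contDiffOn_writtenInExtChartAt isOpen_univ hf.contMDiffOn x₀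
  have hca := (hC.contDiffAt (hO.mem_nhds (x := extChartAt I x₀ x₀) (by simp))).of_le
    (m := 2) ENat.LEInfty.out
  have hrel : ∀ (V : (x : X) → TangentSpace I x) (V' : (y : M) → TangentSpace I' y),
      (∀ x, mfderiv I I' f x (V x) = V' (f x)) → ∀ᶠ z in 𝓝 (extChartAt I x₀ x₀),
        fderiv ℝ (writtenInExtChartAt I I' x₀ f) z (chartField V x₀ z) =
          chartField V' (f x₀) (writtenInExtChartAt I I' x₀ f z) := by
    intro V V' h
    filter_upwards [eventually_mem_chart_domains (I := I) (I' := I') (hd x₀).continuousAt]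
      with z hz
    rw [chartField_apply V hz.1]
    exact fderiv_writtenInExtChartAt_apply hz.1 hz.2 (hd _) (h _)
  have := fderiv_lieBracket_of_related hca (differentiableAt_chartField hV)
    (differentiableAt_chartField hW) (by rw [hfx]; exact differentiableAt_chartField hV')
    (by rw [hfx]; exact differentiableAt_chartField hW') (hrel V V' hVV') (hrel W W' hWW')
  rw [fderiv_writtenInExtChartAt_self (hd x₀), hfx] at this
  rw [mlieBracket_eq_lieBracket_chartField, mlieBracket_eq_lieBracket_chartField]
  exact this

/-- The Lie bracket of two vector fields tangent to an immersion is tangent to the immersion. -/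
theorem mlieBracket_mem_range_mfderiv [FiniteDimensional ℝ E'] {f : X → M}
    (hf : ContMDiff I I' ∞ f) (x₀ : X)
    (hinj : Function.Injective (mfderiv I I' f x₀)) {V' W' : (y : M) → TangentSpace I' y}
    (hV' : MDifferentiableAt I' I'.tangent (fun x => (⟨x, V' x⟩ : TangentBundle I' M)) (f x₀))
    (hW' : MDifferentiableAt I' I'.tangent (fun x => (⟨x, W' x⟩ : TangentBundle I' M)) (f x₀))
    (hV : ∀ x, V' (f x) ∈ (mfderiv I I' f x).range)
    (hW : ∀ x, W' (f x) ∈ (mfderiv I I' f x).range) :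
    mlieBracket I' V' W' (f x₀) ∈ (mfderiv I I' f x₀).range := by
  have hd : ∀ x, MDifferentiableAt I I' f x := fun x => hf.mdifferentiableAt (by simp)
  have hfx : writtenInExtChartAt I I' x₀ f (extChartAt I x₀ x₀) = extChartAt I' (f x₀) (f x₀) := by
    simp [writtenInExtChartAt]
  obtain ⟨hO, hC⟩ := contDiffOn_writtenInExtChartAt isOpen_univ hf.contMDiffOn x₀
  have hca := (hC.contDiffAt (hO.mem_nhds (x := extChartAt I x₀ x₀) (by simp))).of_le
    (m := 2) ENat.LEInfty.out
  have hself := fderiv_writtenInExtChartAt_self (hd x₀)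
  have hlift : ∀ (V' : (y : M) → TangentSpace I' y),
      MDifferentiableAt I' I'.tangent (fun x => (⟨x, V' x⟩ : TangentBundle I' M)) (f x₀) →
      (∀ x, V' (f x) ∈ (mfderiv I I' f x).range) →
      ∃ V : E → E, DifferentiableAt ℝ V (extChartAt I x₀ x₀) ∧ ∀ᶠ z in 𝓝 (extChartAt I x₀ x₀),
        fderiv ℝ (writtenInExtChartAt I I' x₀ f) z (V z) =
          chartField V' (f x₀) (writtenInExtChartAt I I' x₀ f z) := by
    intro V' hV' h
    refine exists_differentiableAt_lift hca (by rw [hself]; exact hinj)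
      (DifferentiableAt.comp _ (by rw [hfx]; exact differentiableAt_chartField hV')
        (hca.differentiableAt (by simp))) ?_
    filter_upwards [eventually_mem_chart_domains (I := I) (I' := I') (hd x₀).continuousAt]
      with z hz
    obtain ⟨u, hu⟩ := h ((extChartAt I x₀).symm z)
    exact ⟨_, fderiv_writtenInExtChartAt_apply hz.1 hz.2 (hd _) hu⟩
  obtain ⟨V, hVd, hVr⟩ := hlift V' hV' hV
  obtain ⟨W, hWd, hWr⟩ := hlift W' hW' hW
  have := fderiv_lieBracket_of_related hca hVd hWd
    (by rw [hfx]; exact differentiableAt_chartField hV')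
    (by rw [hfx]; exact differentiableAt_chartField hW') hVr hWr
  rw [hself, hfx] at this
  rw [mlieBracket_eq_lieBracket_chartField]
  exact ⟨_, this⟩

end Brackets

end GManifold

namespace GManifold

theorem mfderiv_apply_of_eq_comp {E : Type*} [NormedAddCommGroup E] [NormedSpace ℝ E]
    {H : Type*} [TopologicalSpace H] {I : ModelWithCorners ℝ E H}
    {X : Type*} [TopologicalSpace X] [ChartedSpace H X]
    {E' : Type*} [NormedAddCommGroup E'] [NormedSpace ℝ E']
    {H' : Type*} [TopologicalSpace H'] {I' : ModelWithCorners ℝ E' H'}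
    {Y : Type*} [TopologicalSpace Y] [ChartedSpace H' Y]
    {E'' : Type*} [NormedAddCommGroup E''] [NormedSpace ℝ E'']
    {H'' : Type*} [TopologicalSpace H''] {I'' : ModelWithCorners ℝ E'' H''}
    {Z : Type*} [TopologicalSpace Z] [ChartedSpace H'' Z] {F : X → Z} {g : Y → Z} {f : X → Y}
    (h : F = g ∘ f) {x : X} (hg : MDifferentiableAt I' I'' g (f x))
    (hf : MDifferentiableAt I I' f x) (v : TangentSpace I x) :
    (mfderiv I I'' F x v : E'') = mfderiv I' I'' g (f x) (mfderiv I I' f x v) := by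
  subst h
  exact mfderiv_comp_apply x hg hf v

theorem mfderiv_surjective_of_inverse {E : Type*} [NormedAddCommGroup E] [NormedSpace ℝ E]
    {H : Type*} [TopologicalSpace H] {I : ModelWithCorners ℝ E H}
    {X : Type*} [TopologicalSpace X] [ChartedSpace H X]
    {E' : Type*} [NormedAddCommGroup E'] [NormedSpace ℝ E']
    {H' : Type*} [TopologicalSpace H'] {I' : ModelWithCorners ℝ E' H'}
    {Y : Type*} [TopologicalSpace Y] [ChartedSpace H' Y] {f : X → Y} {k : Y → X}
    (hf : MDifferentiable I I' f) (hk : MDifferentiable I' I k) (hfk : ∀ y, f (k y) = y)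
    {x : X} (hkf : k (f x) = x) : Function.Surjective (mfderiv I I' f x) := by
  intro v
  refine ⟨mfderiv I' I k (f x) v, ?_⟩
  have h1 := mfderiv_comp_apply_of_eq (I := I') (I' := I) (I'' := I') (g := f) (f := k)
    (f x) (hf x) (hk (f x)) hkf v
  have h2 : f ∘ k = id := funext hfk
  rw [h2, mfderiv_id] at h1
  exact h1.symm

section Action

variable {EG : Type*} [NormedAddCommGroup EG] [NormedSpace ℝ EG] [FiniteDimensional ℝ EG]
  {HG : Type*} [TopologicalSpace HG] {J : ModelWithCorners ℝ EG HG} [J.Boundaryless]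
  {G : Type*} [TopologicalSpace G] [ChartedSpace HG G] [Group G] [LieGroup J ∞ G]
  {E : Type*} [NormedAddCommGroup E] [NormedSpace ℝ E] [FiniteDimensional ℝ E]
  {H : Type*} [TopologicalSpace H] {I : ModelWithCorners ℝ E H} [I.Boundaryless]
  {M : Type*} [TopologicalSpace M] [ChartedSpace H M] [IsManifold I ∞ M]
  [MulAction G M] [ContMDiffSMul J I ∞ G M]

variable (J I G) in
theorem contMDiff_orbitMap (p : M) : ContMDiff J I ∞ (fun g : G => g • p) :=
  contMDiff_id.smul (I := J) contMDiff_const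

variable (J) in
theorem mfderiv_mul_right_surjective (g h : G) :
    Function.Surjective (mfderiv J J (fun x : G => x * g) h) :=
  mfderiv_surjective_of_inverse (k := fun x => x * g⁻¹)
    ((contMDiff_mul_right (I := J) (n := ∞)).mdifferentiable (by simp))
    ((contMDiff_mul_right (I := J) (n := ∞)).mdifferentiable (by simp))
    (fun y => by simp) (by simp)

theorem actionField_smul_apply (g : G) (p : M) (v : GroupLieAlgebra J G) :
    actionField I (g • p) v =
      mfderiv J I (fun h : G => h • p) g (mfderiv J J (fun x : G => x * g) 1 v) := by
  have h1 : (fun h : G => h • g • p) = (fun h : G => h • p) ∘ (fun x : G => x * g) := by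
    ext h
    simp [mul_smul]
  rw [actionField, h1]
  exact mfderiv_comp_apply_of_eq _ ((contMDiff_orbitMap J G I p).mdifferentiableAt (by simp))
    ((contMDiff_mul_right (I := J) (n := ∞)).mdifferentiableAt (by simp)) (one_mul g) v

theorem range_mfderiv_orbitMap (g : G) (p : M) :
    (mfderiv J I (fun h : G => h • p) g).range =
      (actionField I (g • p) : GroupLieAlgebra J G →L[ℝ] TangentSpace I (g • p)).range := by
  ext w
  constructor
  · rintro ⟨u, rfl⟩
    obtain ⟨v, hv⟩ := mfderiv_mul_right_surjective J g 1 u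
    refine ⟨v, ?_⟩
    rw [← hv]
    exact actionField_smul_apply g p v
  · rintro ⟨v, rfl⟩
    exact ⟨_, (actionField_smul_apply g p v).symm⟩

theorem finrank_range_mfderiv_le_of_eq_comp {EX : Type*} [NormedAddCommGroup EX]
    [NormedSpace ℝ EX] {HX : Type*} [TopologicalSpace HX] {IX : ModelWithCorners ℝ EX HX}
    {X : Type*} [TopologicalSpace X] [ChartedSpace HX X] {F : X → M} {τ : X → X} {σ : M → M}
    (hF : MDifferentiable IX I F) (hτ : MDifferentiable IX IX τ) (hσ : MDifferentiable I I σ)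
    (h : ∀ x, F x = σ (F (τ x))) {x y : X} (hy : τ x = y) :
    Module.finrank ℝ (mfderiv IX I F x).range ≤ Module.finrank ℝ (mfderiv IX I F y).range := by
  subst hy
  have h2 : ∀ v : TangentSpace IX x, (mfderiv IX I F x v : E) = mfderiv I I σ (F (τ x))
      (mfderiv IX I F (τ x) (mfderiv IX IX τ x v)) := fun v =>
    (mfderiv_apply_of_eq_comp (f := F ∘ τ) (funext h) (hσ _) ((hF _).comp x (hτ x)) v).trans
      (congrArg (fun w : E => mfderiv I I σ (F (τ x)) w)
        (mfderiv_comp_apply x (hF _) (hτ x) v))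
  exact finrank_range_le_of_eq_comp _ _ _ h2

theorem finrank_range_mfderiv_orbitMap (p : M) (g h : G) :
    Module.finrank ℝ (mfderiv J I (fun x : G => x • p) g).range =
      Module.finrank ℝ (mfderiv J I (fun x : G => x • p) h).range := by
  have key : ∀ g h : G, Module.finrank ℝ (mfderiv J I (fun x : G => x • p) g).range ≤
      Module.finrank ℝ (mfderiv J I (fun x : G => x • p) h).range := fun g h =>
    finrank_range_mfderiv_le_of_eq_comp (σ := fun z : M => (g * h⁻¹) • z)
      (τ := fun x => (g * h⁻¹)⁻¹ * x)
      ((contMDiff_orbitMap J G I p).mdifferentiable (by simp))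
      ((contMDiff_mul_left (I := J) (n := ∞)).mdifferentiable (by simp))
      ((ContMDiffSMul.contMDiff_const_smul (I := J) (n := ∞) _).mdifferentiable (by simp))
      (fun x => by simp only [smul_smul]; group) (by group)
  exact le_antisymm (key g h) (key h g)

variable (I M) in
theorem contMDiff_actionField (v : GroupLieAlgebra J G) :
    ContMDiff I I.tangent ∞ (fun x : M => (⟨x, actionField I x v⟩ : TangentBundle I M)) := by
  have : IsManifold I (∞ + 1) M := inferInstanceAs (IsManifold I ∞ M)
  have : IsManifold J (∞ + 1) G := inferInstanceAs (IsManifold J ∞ G)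
  let S₁ : M → TangentBundle J G × TangentBundle I M := fun x => (⟨1, v⟩, ⟨x, 0⟩)
  have h₁ : ContMDiff I (J.tangent.prod I.tangent) ∞ S₁ :=
    contMDiff_const.prodMk (Bundle.contMDiff_zeroSection ℝ (TangentSpace I : M → Type _))
  have h₂ : ContMDiff (J.tangent.prod I.tangent) (J.prod I).tangent ∞
    (equivTangentBundleProd J G I M).symm := contMDiff_equivTangentBundleProd_symm
  have h₃ : ContMDiff (J.prod I).tangent I.tangent ∞
      (tangentMap (J.prod I) I (fun q : G × M => q.1 • q.2)) :=
    (contMDiff_smul (I := J) (I' := I) (n := ∞)).contMDiff_tangentMap le_rfl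
  have h := (h₃.comp h₂).comp h₁
  convert! h using 1
  funext x
  have hd : MDifferentiableAt (J.prod I) I (fun q : G × M => q.1 • q.2) (1, x) :=
    (contMDiff_smul (I := J) (I' := I) (n := ∞)).mdifferentiableAt (by simp)
  simp only [Function.comp_apply, tangentMap, S₁]
  refine Bundle.TotalSpace.ext (one_smul G x).symm (heq_of_eq ?_)
  refine Eq.trans ?_ (mfderiv_prod_eq_add_apply (v := ((v, 0) : EG × E)) hd).symm
  refine Eq.trans (add_zero _).symm (congrArg (fun w : E => _ + w) ?_)
  exact (map_zero (mfderiv I I (fun z : M => (1 : G) • z) x)).symm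

theorem mfderiv_inv_one (v : GroupLieAlgebra J G) :
    (mfderiv J J (fun g : G => g⁻¹) 1 v : EG) = -(v : EG) := by
  have hinv : MDifferentiableAt J J (fun g : G => g⁻¹) 1 :=
    (contMDiff_inv J ∞).mdifferentiableAt (by simp)
  have hmul : MDifferentiableAt (J.prod J) J (fun q : G × G => q.1 * q.2) (1, 1⁻¹) :=
    (contMDiff_mul J ∞).mdifferentiableAt (by simp)
  have h0 : (fun _ : G => (1 : G)) = (fun q : G × G => q.1 * q.2) ∘ (fun g : G => (g, g⁻¹)) := by
    ext g
    simp
  have h1 := mfderiv_apply_of_eq_comp h0 hmul (mdifferentiableAt_id.prodMk hinv) v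
  have h2 := mfderiv_prod_eq_add_apply
    (v := mfderiv J (J.prod J) (fun g : G => (g, g⁻¹)) 1 v) hmul
  have h3 : mfderiv J (J.prod J) (fun g : G => (g, g⁻¹)) 1 =
    (mfderiv J J (fun g : G => g) 1).prod (mfderiv J J (fun g : G => g⁻¹) 1) :=
    mdifferentiableAt_id.mfderiv_prod hinv
  have h4 : (fun z : G => z * 1⁻¹) = id := by ext; simp
  have h5 : (fun z : G => 1 * z) = id := by ext; simp
  have h6 : (mfderiv J J (fun _ : G => (1 : G)) 1 v : EG) = 0 := by
    rw [mfderiv_const]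
    rfl
  let u : EG := v
  let ν : EG := mfderiv J J (fun g : G => g⁻¹) 1 v
  have h7 : (mfderiv J (J.prod J) (fun g : G => (g, g⁻¹)) 1 v : EG × EG) = (u, ν) := by
    rw [h3]
    refine Prod.ext ?_ rfl
    change (mfderiv J J (id : G → G) 1 v : EG) = v
    rw [mfderiv_id]
    rfl
  have h8 : ∀ a : EG × EG, a = (u, ν) → ∀ b c : EG,
      b = mfderiv J J (fun z : G => z * 1⁻¹) 1 a.1 →
      c = mfderiv J J (fun z : G => 1 * z) 1⁻¹ a.2 → b + c = u + ν := by
    rintro _ rfl _ _ rfl rfl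
    rw [h4, h5, mfderiv_id, mfderiv_id]
    rfl
  have h9 : u + ν = 0 := (h8 _ h7 _ _ rfl rfl).symm.trans ((h1.trans h2).symm.trans h6)
  exact eq_neg_of_add_eq_zero_right h9

/-- The map `g ↦ g⁻¹ • p` relates left invariant fields to action fields. -/
theorem mfderiv_inv_smul_mulInvariantVectorField (p : M) (v : GroupLieAlgebra J G) (g : G) :
    (mfderiv J I (fun h : G => h⁻¹ • p) g (mulInvariantVectorField v g) : E) =
      actionField I (g⁻¹ • p) (-v) := by
  have hinv : MDifferentiable J J (fun g : G => g⁻¹) :=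
    (contMDiff_inv J ∞).mdifferentiable (by simp)
  have hφ : ∀ q : M, MDifferentiable J I (fun h : G => h • q) := fun q =>
    (contMDiff_orbitMap J G I q).mdifferentiable (by simp)
  have hL : MDifferentiable J J (fun x : G => g * x) :=
    (contMDiff_mul_left (I := J) (n := ∞)).mdifferentiable (by simp)
  have h1 : (fun h : G => h⁻¹ • p) ∘ (fun x : G => g * x) =
      (fun h : G => h • g⁻¹ • p) ∘ (fun h : G => h⁻¹) := by
    ext h
    simp [mul_smul]
  have h2 : (mfderiv J I ((fun h : G => h⁻¹ • p) ∘ (fun x : G => g * x)) 1 v : E) = _ :=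
    mfderiv_comp_apply_of_eq (x := (1 : G)) (y := g)
      ((hφ p _).comp g (hinv g)) (hL 1) (mul_one g) v
  have h3 : (mfderiv J I ((fun h : G => h⁻¹ • p) ∘ (fun x : G => g * x)) 1 v : E) = _ :=
    mfderiv_apply_of_eq_comp h1 (hφ _ _) (hinv 1) v
  refine h2.symm.trans (h3.trans ?_)
  have h4 : ∀ a : G, a = 1 → ∀ u : EG, u = -(v : EG) →
      (mfderiv J I (fun h : G => h • g⁻¹ • p) a u : E) = actionField I (g⁻¹ • p) (-v) := by
    rintro _ rfl _ rfl
    rfl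
  exact h4 _ inv_one _ (mfderiv_inv_one v)

/-- Up to sign, the bracket of action fields is the action field of the bracket. -/
theorem actionField_neg_lie (p : M) (v w : GroupLieAlgebra J G) :
    (actionField I p (-⁅v, w⁆) : E) = VectorField.mlieBracket I
      (fun x : M => actionField I x (-v)) (fun x : M => actionField I x (-w)) p := by
  have : LieGroup J (minSmoothness ℝ 3) G := by
    rw [minSmoothness_of_isRCLikeNormedField]
    infer_instance
  have hone : ∀ u : GroupLieAlgebra J G, mulInvariantVectorField u 1 = u := by
    intro u
    have : (fun x : G => 1 * x) = id := by ext; simp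
    rw [mulInvariantVectorField, this, mfderiv_id]
    rfl
  have h := mfderiv_mlieBracket_of_related (f := fun h : G => h⁻¹ • p) (I := J) (I' := I)
    ((contMDiff_orbitMap J G I p).comp (contMDiff_inv J ∞)) 1
    (mdifferentiableAt_mulInvariantVectorField v) (mdifferentiableAt_mulInvariantVectorField w)
    ((contMDiff_actionField I M (-v)).mdifferentiableAt (by simp))
    ((contMDiff_actionField I M (-w)).mdifferentiableAt (by simp))
    (mfderiv_inv_smul_mulInvariantVectorField p v)
    (mfderiv_inv_smul_mulInvariantVectorField p w)
  have h' := mfderiv_inv_smul_mulInvariantVectorField (I := I) p ⁅v, w⁆ 1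
  rw [hone, GroupLieAlgebra.bracket_def] at h'
  have key : ∀ q : M, q = p →
      (actionField I q (-⁅v, w⁆) : E) = VectorField.mlieBracket I
        (fun x : M => actionField I x (-v)) (fun x : M => actionField I x (-w)) q →
      (actionField I p (-⁅v, w⁆) : E) = VectorField.mlieBracket I
        (fun x : M => actionField I x (-v)) (fun x : M => actionField I x (-w)) p := by
    rintro _ rfl h
    exact h
  exact key _ (by simp) (h'.symm.trans h)

theorem isSection_actionField {m : Submodule ℝ (GroupLieAlgebra J G)} {v : GroupLieAlgebra J G}
    (hv : v ∈ m) : IsSection (actionDistribution I m) (fun x : M => actionField I x v) :=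
  ⟨contMDiff_actionField I M v, fun _ => ⟨v, hv, rfl⟩⟩

theorem range_actionField_le_of_involutiveAt {m : Submodule ℝ (GroupLieAlgebra J G)}
    (hm : m ⊔ bracketSpan m = ⊤) {p : M} (h : InvolutiveAt (actionDistribution I m) p) :
    (actionField I p : GroupLieAlgebra J G →L[ℝ] TangentSpace I p).range ≤
      actionDistribution I m p := by
  have h1 : m ≤ (actionDistribution I m p).comap
      (actionField I p : GroupLieAlgebra J G →L[ℝ] TangentSpace I p).toLinearMap :=
    Submodule.le_comap_map _ _
  have h2 : bracketSpan m ≤ (actionDistribution I m p).comap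
      (actionField I p : GroupLieAlgebra J G →L[ℝ] TangentSpace I p).toLinearMap := by
    refine Submodule.span_le.2 ?_
    rintro _ ⟨v, hv, w, hw, rfl⟩
    have h3 : actionField I p (-⁅v, w⁆) ∈ actionDistribution I m p := by
      rw [InvolutiveAt] at h
      rw [← h]
      exact Submodule.mem_sup_right (Submodule.subset_span
        ⟨_, _, isSection_actionField (neg_mem hv), isSection_actionField (neg_mem hw),
          actionField_neg_lie p v w⟩)
    rw [map_neg, neg_mem_iff] at h3
    exact h3
  rintro _ ⟨v, rfl⟩
  exact sup_le h1 h2 (hm ▸ Submodule.mem_top : v ∈ m ⊔ bracketSpan m)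

/-- A distribution is involutive along its integral leaves. -/
theorem involutiveAt_of_isIntegralLeaf {D : Distribution I M} {N : ImmersedSubmanifold I M}
    (hN : N.IsIntegralLeaf D) (q : N.carrier) : InvolutiveAt D (N.incl q) := by
  refine sup_eq_left.2 (Submodule.span_le.2 ?_)
  rintro _ ⟨X, Y, hX, hY, rfl⟩
  have h : ∀ Z : (x : M) → TangentSpace I x, IsSection D Z → ∀ x : N.carrier,
      Z (N.incl x) ∈ (mfderiv (𝓡 N.dim) I N.incl x).range := by
    intro Z hZ x
    have h1 := hZ.2 (N.incl x)
    rw [← hN x] at h1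
    exact h1
  rw [SetLike.mem_coe, ← hN q]
  exact mlieBracket_mem_range_mfderiv N.contMDiff_incl q (N.injective_mfderiv q)
    (hX.1.mdifferentiableAt (by simp)) (hY.1.mdifferentiableAt (by simp)) (h X hX) (h Y hY)

end Action

end GManifold

namespace GManifold

universe u

section Orbits

variable {EG : Type*} [NormedAddCommGroup EG] [NormedSpace ℝ EG]
  {HG : Type*} [TopologicalSpace HG] {J : ModelWithCorners ℝ EG HG}
  {G : Type*} [TopologicalSpace G] [ChartedSpace HG G] [Group G]
  {E : Type*} [NormedAddCommGroup E] [NormedSpace ℝ E]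
  {H : Type*} [TopologicalSpace H] {I : ModelWithCorners ℝ E H}
  {M : Type u} [TopologicalSpace M] [ChartedSpace H M] [MulAction G M]

variable (J I G) in
/-- Local coordinates for the orbit of `p` near `p`: a function `coord` on `M` that classifies the
points `g • p` with `g ∈ nbhd`, together with a smooth section `lift`. -/
structure OrbitSlice (p : M) (n : ℕ) where
  /-- Domain of the coordinates. -/
  domain : Set M
  /-- A neighbourhood of `1` in the group. -/
  nbhd : Set G
  /-- The coordinate space. -/
  target : Set (EuclideanSpace ℝ (Fin n))
  /-- The coordinates. -/
  coord : M → EuclideanSpace ℝ (Fin n)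
  /-- The lift of the coordinates to the group. -/
  lift : EuclideanSpace ℝ (Fin n) → G
  isOpen_domain : IsOpen domain
  isOpen_nbhd : IsOpen nbhd
  isOpen_target : IsOpen target
  one_mem : 1 ∈ nbhd
  contMDiffOn_coord : ContMDiffOn I (𝓡 n) ∞ coord domain
  contMDiffOn_lift : ContMDiffOn (𝓡 n) J ∞ lift target
  smul_mem : ∀ g ∈ nbhd, g • p ∈ domain
  coord_mem : ∀ g ∈ nbhd, coord (g • p) ∈ target
  lift_mem : ∀ v ∈ target, lift v ∈ nbhd
  coord_lift : ∀ v ∈ target, coord (lift v • p) = v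
  lift_coord : ∀ g ∈ nbhd, lift (coord (g • p)) • p = g • p

theorem exists_orbitSlice [FiniteDimensional ℝ EG] [J.Boundaryless] [LieGroup J ∞ G]
    [FiniteDimensional ℝ E] [I.Boundaryless] [IsManifold I ∞ M] [ContMDiffSMul J I ∞ G M]
    (p : M) {n : ℕ} (hn : Module.finrank ℝ (mfderiv J I (fun g : G => g • p) 1).range = n) :
    Nonempty (OrbitSlice J G I p n) := by
  have hφ := contMDiff_orbitMap J G I p
  obtain ⟨h, W, U, hW, h1W, hh, hU, h1U, hUW, hs, hfib⟩ :=
    exists_submersion_of_finrank_range_mfderiv_le hφ 1 hn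
      (fun x => (finrank_range_mfderiv_orbitMap p x 1).trans_le hn.le)
  have hcomp : ContMDiffOn J (𝓡 n) ∞ (h ∘ fun g : G => g • p) U :=
    hh.comp hφ.contMDiffOn hUW
  have hd : MDifferentiableAt I (𝓡 n) h ((1 : G) • p) :=
    (hh.contMDiffAt (hW.mem_nhds h1W)).mdifferentiableAt (by simp)
  obtain ⟨B, s, hB, h1B, hs', hsU, hsec, hs1⟩ := exists_localSection_of_surjective_mfderiv hU
    hcomp h1U (by
      rw [mfderiv_comp 1 hd (hφ.mdifferentiableAt (by simp))]
      exact hs)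
  refine ⟨W, U ∩ (h ∘ fun g : G => g • p) ⁻¹' B, B, h, s, hW,
    hcomp.continuousOn.isOpen_inter_preimage hU hB, hB, ⟨h1U, h1B⟩, hh, hs',
    fun g hg => hUW hg.1, fun g hg => hg.2, fun v hv => ⟨hsU hv, ?_⟩, hsec,
    fun g hg => hfib _ (hsU hg.2) _ hg.1 (hsec _ hg.2)⟩
  rw [mem_preimage, hsec v hv]
  exact hv

namespace OrbitSlice

variable {p : M} {n : ℕ}

/-- The orbit of `p`, as a manifold with the charts coming from a slice. -/
def Orbit (_σ : OrbitSlice J G I p n) : Type u := MulAction.orbit G p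

variable (σ : OrbitSlice J G I p n)

/-- The orbit map onto the orbit. -/
def proj (g : G) : σ.Orbit := ⟨g • p, MulAction.mem_orbit p g⟩

/-- The inclusion of the orbit. -/
def incl (y : σ.Orbit) : M := y.1

instance : TopologicalSpace σ.Orbit := TopologicalSpace.coinduced σ.proj inferInstance

theorem incl_proj (g : G) : σ.incl (σ.proj g) = g • p := rfl

theorem incl_injective : Function.Injective σ.incl := Subtype.val_injective

theorem proj_eq_iff {g h : G} : σ.proj g = σ.proj h ↔ g • p = h • p :=
  σ.incl_injective.eq_iff.symm

theorem proj_surjective : Function.Surjective σ.proj := fun y => by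
  obtain ⟨g, hg⟩ := y.2
  exact ⟨g, Subtype.ext hg⟩

theorem continuous_proj : Continuous σ.proj := continuous_coinduced_rng

theorem isQuotientMap_proj : IsQuotientMap σ.proj := ⟨⟨rfl⟩, σ.proj_surjective⟩

section Manifold

variable [FiniteDimensional ℝ EG] [J.Boundaryless] [FiniteDimensional ℝ E] [I.Boundaryless]
  [LieGroup J ∞ G]

include J in
theorem isOpenMap_proj : IsOpenMap σ.proj := by
  intro U hU
  rw [← σ.isQuotientMap_proj.isOpen_preimage]
  have : σ.proj ⁻¹' (σ.proj '' U) = ⋃ k ∈ MulAction.stabilizer G p, (fun x => x * k) ⁻¹' U := by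
    ext g
    simp only [mem_preimage, mem_image, mem_iUnion, MulAction.mem_stabilizer_iff, exists_prop]
    constructor
    · rintro ⟨u, hu, hug⟩
      rw [proj_eq_iff] at hug
      exact ⟨g⁻¹ * u, by rw [mul_smul, hug, inv_smul_smul], by simpa using hu⟩
    · rintro ⟨k, hk, hgk⟩
      exact ⟨g * k, hgk, by rw [proj_eq_iff, mul_smul, hk]⟩
  rw [this]
  exact isOpen_biUnion fun k _ =>
    hU.preimage (contMDiff_mul_right (I := J) (n := ∞) (a := k)).continuous

variable [IsManifold I ∞ M] [ContMDiffSMul J I ∞ G M]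

include J I in
theorem continuous_incl : Continuous σ.incl :=
  σ.isQuotientMap_proj.continuous_iff.2 (contMDiff_orbitMap J G I p).continuous

/-- The chart of the orbit around `g • p`. -/
def chart (g : G) : OpenPartialHomeomorph σ.Orbit (EuclideanSpace ℝ (Fin n)) where
  toFun y := σ.coord (g⁻¹ • σ.incl y)
  invFun v := σ.proj (g * σ.lift v)
  source := σ.proj '' ((fun x => g⁻¹ * x) ⁻¹' σ.nbhd)
  target := σ.target
  map_source' := by
    rintro _ ⟨x, hx, rfl⟩
    rw [incl_proj, ← mul_smul]
    exact σ.coord_mem _ hx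
  map_target' v hv := ⟨g * σ.lift v, by simpa using σ.lift_mem v hv, rfl⟩
  left_inv' := by
    rintro _ ⟨x, hx, rfl⟩
    rw [incl_proj, ← mul_smul, proj_eq_iff, mul_smul, σ.lift_coord _ hx, ← mul_smul,
      mul_inv_cancel_left]
  right_inv' v hv := by
    rw [incl_proj, ← mul_smul, inv_mul_cancel_left, σ.coord_lift v hv]
  open_source := σ.isOpenMap_proj _
    (σ.isOpen_nbhd.preimage (contMDiff_mul_left (I := J) (n := ∞) (a := g⁻¹)).continuous)
  open_target := σ.isOpen_target
  continuousOn_toFun := by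
    refine σ.contMDiffOn_coord.continuousOn.comp
      ((ContMDiffSMul.contMDiff_const_smul (I := J) (I' := I) (n := ∞) g⁻¹).continuous.comp
        σ.continuous_incl).continuousOn ?_
    rintro _ ⟨x, hx, rfl⟩
    change g⁻¹ • x • p ∈ _
    rw [← mul_smul]
    exact σ.smul_mem _ hx
  continuousOn_invFun := σ.continuous_proj.comp_continuousOn
    ((contMDiff_mul_left (I := J) (n := ∞) (a := g)).continuous.comp_continuousOn
      σ.contMDiffOn_lift.continuousOn)

theorem proj_mem_chart_source (g : G) : σ.proj g ∈ (σ.chart g).source :=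
  ⟨g, by simpa using σ.one_mem, rfl⟩

theorem smul_incl_mem_domain {g : G} {y : σ.Orbit} (hy : y ∈ (σ.chart g).source) :
    g⁻¹ • σ.incl y ∈ σ.domain := by
  obtain ⟨x, hx, rfl⟩ := hy
  rw [incl_proj, ← mul_smul]
  exact σ.smul_mem _ hx

instance : ChartedSpace (EuclideanSpace ℝ (Fin n)) σ.Orbit where
  atlas := range σ.chart
  chartAt y := σ.chart (σ.proj_surjective y).choose
  mem_chart_source y := by
    have h := (σ.proj_surjective y).choose_spec
    have := σ.proj_mem_chart_source (σ.proj_surjective y).choose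
    rwa [h] at this
  chart_mem_atlas y := mem_range_self _

theorem contMDiffOn_coord_smul (g : G) :
    ContMDiffOn I (𝓡 n) ∞ (fun x => σ.coord (g • x)) ((fun x => g • x) ⁻¹' σ.domain) :=
  σ.contMDiffOn_coord.comp
    (ContMDiffSMul.contMDiff_const_smul (I := J) (I' := I) (n := ∞) g).contMDiffOn fun _ hx => hx

theorem contMDiffOn_mul_lift_smul (g : G) :
    ContMDiffOn (𝓡 n) I ∞ (fun v => (g * σ.lift v) • p) σ.target :=
  (contMDiff_orbitMap J G I p).comp_contMDiffOn
    ((contMDiff_mul_left (I := J) (n := ∞) (a := g)).comp_contMDiffOn σ.contMDiffOn_lift)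

instance : IsManifold (𝓡 n) ∞ σ.Orbit := by
  refine isManifold_of_contDiffOn _ _ _ ?_
  rintro _ _ ⟨g, rfl⟩ ⟨k, rfl⟩
  simp only [modelWithCornersSelf_coe, modelWithCornersSelf_coe_symm, Function.comp_id,
    Function.id_comp, preimage_id, range_id, inter_univ]
  rw [← contMDiffOn_iff_contDiffOn]
  refine (σ.contMDiffOn_coord_smul k⁻¹).comp ((σ.contMDiffOn_mul_lift_smul g).mono ?_) ?_
  · exact fun v hv => hv.1
  · exact fun v hv => σ.smul_incl_mem_domain hv.2

theorem chart_mem_maximalAtlas (g : G) : σ.chart g ∈ IsManifold.maximalAtlas (𝓡 n) ∞ σ.Orbit :=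
  IsManifold.subset_maximalAtlas (mem_range_self g)

theorem contMDiffOn_chart (g : G) :
    ContMDiffOn (𝓡 n) (𝓡 n) ∞ (σ.chart g) (σ.chart g).source :=
  contMDiffOn_of_mem_maximalAtlas (σ.chart_mem_maximalAtlas g)

theorem contMDiffOn_chart_symm (g : G) :
    ContMDiffOn (𝓡 n) (𝓡 n) ∞ (σ.chart g).symm (σ.chart g).target :=
  contMDiffOn_symm_of_mem_maximalAtlas (σ.chart_mem_maximalAtlas g)

theorem contMDiff_incl : ContMDiff (𝓡 n) I ∞ σ.incl := by
  intro y
  obtain ⟨g, rfl⟩ := σ.proj_surjective y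
  have h := (σ.contMDiffOn_mul_lift_smul g).comp (σ.contMDiffOn_chart g)
    (fun y hy => (σ.chart g).map_source hy)
  refine ContMDiffOn.contMDiffAt (h.congr fun y hy => ?_)
    ((σ.chart g).open_source.mem_nhds (σ.proj_mem_chart_source g))
  exact congrArg σ.incl ((σ.chart g).left_inv hy).symm

theorem contMDiff_proj : ContMDiff J (𝓡 n) ∞ σ.proj := by
  intro g
  have h1 : ContMDiffOn J (𝓡 n) ∞ (fun x : G => σ.chart g (σ.proj x))
      (σ.proj ⁻¹' (σ.chart g).source) :=
    (σ.contMDiffOn_coord_smul g⁻¹).comp (contMDiff_orbitMap J G I p).contMDiffOn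
      fun x hx => σ.smul_incl_mem_domain hx
  have h2 := (σ.contMDiffOn_chart_symm g).comp h1 fun x hx => (σ.chart g).map_source hx
  refine ContMDiffOn.contMDiffAt (h2.congr fun x hx => ?_)
    (((σ.chart g).open_source.preimage σ.continuous_proj).mem_nhds (σ.proj_mem_chart_source g))
  exact ((σ.chart g).left_inv hx).symm

theorem injective_mfderiv_incl (y : σ.Orbit) : Function.Injective (mfderiv (𝓡 n) I σ.incl y) := by
  obtain ⟨g, rfl⟩ := σ.proj_surjective y
  have : IsManifold (𝓡 n) 1 σ.Orbit := IsManifold.of_le (n := ∞) (by simp)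
  have h1 := (mdifferentiable_of_mem_atlas (I := 𝓡 n)
    (mem_range_self g : σ.chart g ∈ atlas _ σ.Orbit)).mfderiv_injective (σ.proj_mem_chart_source g)
  have hmem : σ.incl (σ.proj g) ∈ (fun x => g⁻¹ • x) ⁻¹' σ.domain :=
    σ.smul_incl_mem_domain (σ.proj_mem_chart_source g)
  have h2 : MDifferentiableAt I (𝓡 n) (fun x => σ.coord (g⁻¹ • x)) (σ.incl (σ.proj g)) :=
    ((σ.contMDiffOn_coord_smul g⁻¹).contMDiffAt ((σ.isOpen_domain.preimage
      (ContMDiffSMul.contMDiff_const_smul (I := J) (I' := I) (n := ∞) g⁻¹).continuous).mem_nhds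
        hmem)).mdifferentiableAt (by simp)
  intro v w hvw
  apply h1
  have h3 := mfderiv_apply_of_eq_comp (F := σ.chart g)
    (g := fun x => σ.coord (g⁻¹ • x)) (f := σ.incl) rfl h2
    (σ.contMDiff_incl.mdifferentiableAt (by simp))
  exact (h3 v).trans ((congrArg (fun z : E => mfderiv I (𝓡 n) (fun x => σ.coord (g⁻¹ • x))
    (σ.incl (σ.proj g)) z) hvw).trans (h3 w).symm)

theorem surjective_mfderiv_proj
    (hn : Module.finrank ℝ (mfderiv J I (fun g : G => g • p) 1).range = n) (g : G) :
    Function.Surjective (mfderiv J (𝓡 n) σ.proj g) := by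
  have h1 : ∀ v : TangentSpace J g, (mfderiv J I (fun g : G => g • p) g v : E) =
      mfderiv (𝓡 n) I σ.incl (σ.proj g) (mfderiv J (𝓡 n) σ.proj g v) :=
    mfderiv_apply_of_eq_comp rfl (σ.contMDiff_incl.mdifferentiableAt (by simp))
      (σ.contMDiff_proj.mdifferentiableAt (by simp))
  have h2 := finrank_range_le_of_eq_comp
    (D := (mfderiv J I (fun g : G => g • p) g).toLinearMap) _ _ LinearMap.id h1
  rw [finrank_range_mfderiv_orbitMap p g 1, hn] at h2
  refine LinearMap.range_eq_top.1 (Submodule.eq_top_of_finrank_eq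
    (le_antisymm (Submodule.finrank_le _) (le_trans ?_ h2)))
  exact (finrank_euclideanSpace_fin (𝕜 := ℝ)).le

instance [T2Space M] : T2Space σ.Orbit :=
  T2Space.of_injective_continuous σ.incl_injective σ.continuous_incl

instance [SecondCountableTopology G] : SecondCountableTopology σ.Orbit :=
  σ.isQuotientMap_proj.secondCountableTopology σ.isOpenMap_proj

/-- The orbit as an immersed submanifold. -/
def toImmersedSubmanifold [T2Space M] [SecondCountableTopology G] : ImmersedSubmanifold I M where
  dim := n
  carrier := σ.Orbit
  incl := σ.incl
  injective_incl := σ.incl_injective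
  contMDiff_incl := σ.contMDiff_incl
  injective_mfderiv := σ.injective_mfderiv_incl

theorem isOrbit_toImmersedSubmanifold [T2Space M] [SecondCountableTopology G]
    (hn : Module.finrank ℝ (mfderiv J I (fun g : G => g • p) 1).range = n) :
    σ.toImmersedSubmanifold.IsOrbit J G p :=
  ⟨Subtype.range_coe, σ.proj, fun _ => rfl, σ.contMDiff_proj, σ.surjective_mfderiv_proj hn⟩

end Manifold

end OrbitSlice

end Orbits

end GManifold

namespace GManifold

universe u

namespace ImmersedSubmanifold

section Restrict

variable {E : Type*} [NormedAddCommGroup E] [NormedSpace ℝ E]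
  {H : Type*} [TopologicalSpace H] {I : ModelWithCorners ℝ E H}
  {M : Type u} [TopologicalSpace M] [ChartedSpace H M]

theorem finrank_tangentAt (N : ImmersedSubmanifold I M) (x : N.carrier) :
    Module.finrank ℝ (N.tangentAt x) = N.dim :=
  (LinearMap.finrank_range_of_inj (N.injective_mfderiv x)).trans
    (finrank_euclideanSpace_fin (𝕜 := ℝ))

theorem injective_mfderiv_subtype_val {E' : Type*} [NormedAddCommGroup E'] [NormedSpace ℝ E']
    {H' : Type*} [TopologicalSpace H'] {I' : ModelWithCorners ℝ E' H'}
    {X : Type*} [TopologicalSpace X] [ChartedSpace H' X] (U : TopologicalSpace.Opens X) (u : U) :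
    Function.Injective (mfderiv I' I' (Subtype.val : U → X) u) := by
  classical
  let k : X → U := fun y => if h : y ∈ U then ⟨y, h⟩ else u
  have hk : ∀ y : U, k y = y := fun y => dif_pos y.2
  have h1 : ContMDiffAt I' I' 1 k (u : X) :=
    contMDiffAt_subtype_iff.1 (contMDiffAt_id.congr_of_eventuallyEq (Eventually.of_forall hk))
  have h2 := mfderiv_apply_of_eq_comp (I := I') (F := id) (g := k) (f := (Subtype.val : U → X))
    (x := u) (funext fun y => (hk y).symm) (h1.mdifferentiableAt (by simp))
    ((contMDiff_subtype_val (n := 1)).mdifferentiableAt (by simp))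
  intro v w hvw
  have h3 : (mfderiv I' I' (id : U → U) u v : E') = mfderiv I' I' (id : U → U) u w :=
    (h2 v).trans ((congrArg (fun z : E' => (mfderiv I' I' k (u : X) z : E')) hvw).trans (h2 w).symm)
  rw [mfderiv_id] at h3
  exact h3

/-- An open subset of an immersed submanifold, as an immersed submanifold. -/
def restrict (N : ImmersedSubmanifold I M) (U : TopologicalSpace.Opens N.carrier) :
    ImmersedSubmanifold I M where
  dim := N.dim
  carrier := U
  incl := N.incl ∘ Subtype.val
  injective_incl := N.injective_incl.comp Subtype.val_injective
  contMDiff_incl := N.contMDiff_incl.comp contMDiff_subtype_val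
  injective_mfderiv u := by
    have h := mfderiv_apply_of_eq_comp (F := N.incl ∘ (Subtype.val : U → N.carrier)) rfl
      (N.contMDiff_incl.mdifferentiableAt (by simp) (x := (u : N.carrier)))
      ((contMDiff_subtype_val (I := 𝓡 N.dim) (n := 1)).mdifferentiableAt (by simp) (x := u))
    intro v w hvw
    exact injective_mfderiv_subtype_val U u
      (N.injective_mfderiv u ((h v).symm.trans (Eq.trans hvw (h w))))

theorem tangentAt_restrict (N : ImmersedSubmanifold I M)
    (U : TopologicalSpace.Opens N.carrier) (u : U) : (N.restrict U).tangentAt u = N.tangentAt u := by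
  have h := mfderiv_apply_of_eq_comp (F := N.incl ∘ (Subtype.val : U → N.carrier)) rfl
    (N.contMDiff_incl.mdifferentiableAt (by simp) (x := (u : N.carrier)))
    ((contMDiff_subtype_val (I := 𝓡 N.dim) (n := 1)).mdifferentiableAt (by simp) (x := u))
  have hs : Function.Surjective (mfderiv (𝓡 N.dim) (𝓡 N.dim) (Subtype.val : U → N.carrier) u) :=
    (LinearMap.injective_iff_surjective (K := ℝ) (V := EuclideanSpace ℝ (Fin N.dim))).1
      (injective_mfderiv_subtype_val U u)
  ext w
  constructor
  · rintro ⟨v, rfl⟩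
    exact ⟨_, (h v).symm⟩
  · rintro ⟨v, rfl⟩
    obtain ⟨v', rfl⟩ := hs v
    exact ⟨v', h v'⟩

end Restrict

end ImmersedSubmanifold

section Action

variable {EG : Type*} [NormedAddCommGroup EG] [NormedSpace ℝ EG] [FiniteDimensional ℝ EG]
  {HG : Type*} [TopologicalSpace HG] {J : ModelWithCorners ℝ EG HG} [J.Boundaryless]
  {G : Type*} [TopologicalSpace G] [ChartedSpace HG G] [Group G] [LieGroup J ∞ G]
  {E : Type*} [NormedAddCommGroup E] [NormedSpace ℝ E] [FiniteDimensional ℝ E]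
  {H : Type*} [TopologicalSpace H] {I : ModelWithCorners ℝ E H} [I.Boundaryless]
  {M : Type u} [TopologicalSpace M] [ChartedSpace H M] [IsManifold I ∞ M]
  [MulAction G M] [ContMDiffSMul J I ∞ G M]

/-- The dimension of `D^𝔪` is lower semicontinuous. -/
theorem isOpen_setOf_le_finrank_actionDistribution (m : Submodule ℝ (GroupLieAlgebra J G))
    (n : ℕ) : IsOpen {x : M | n ≤ Module.finrank ℝ (actionDistribution I m x)} := by
  have : IsManifold I 1 M := IsManifold.of_le (n := ∞) (by simp)
  refine isOpen_iff_mem_nhds.2 fun x₀ hx₀ => ?_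
  obtain ⟨b, hb⟩ := exists_linearIndependent_of_le_finrank (R := ℝ) hx₀
  let b' : Fin n → E := fun i => (b i : TangentSpace I x₀)
  have hb' : LinearIndependent ℝ b' :=
    hb.map' (Submodule.subtype _) (Submodule.ker_subtype _)
  choose v hv hvb using fun i => (b i).2
  let c : M → Fin n → E := fun x i =>
    chartField (fun y : M => actionField I y (v i)) x₀ (extChartAt I x₀ x)
  have hc : ContinuousAt c x₀ := continuousAt_pi.2 fun i =>
    ContinuousAt.comp (f := extChartAt I x₀)
      (differentiableAt_chartField
        ((contMDiff_actionField I M (v i)).mdifferentiableAt (by simp))).continuousAt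
      (continuousAt_extChartAt x₀)
  have hc0 : c x₀ = b' := by
    funext i
    refine (chartField_extChartAt _ (mem_extChartAt_source x₀)).trans ?_
    rw [mfderiv_extChartAt_self]
    exact hvb i
  have h1 : ∀ᶠ x in 𝓝 x₀, LinearIndependent ℝ (c x) :=
    hc.eventually (by rw [hc0]; exact hb'.eventually)
  filter_upwards [h1, extChartAt_source_mem_nhds (I := I) x₀] with x hx hxs
  have h2 : c x = fun i => (mfderiv I 𝓘(ℝ, E) (extChartAt I x₀) x (actionField I x (v i)) : E) :=
    funext fun i => chartField_extChartAt _ hxs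
  have h3 : LinearIndependent ℝ fun i => actionField I x (v i) :=
    LinearIndependent.of_comp (mfderiv I 𝓘(ℝ, E) (extChartAt I x₀) x).toLinearMap (by
      rw [h2] at hx
      exact hx)
  have h4 : LinearIndependent ℝ
      (fun i => (⟨actionField I x (v i), v i, hv i, rfl⟩ : actionDistribution I m x)) :=
    LinearIndependent.of_comp (actionDistribution I m x).subtype h3
  simpa using h4.fintype_card_le_finrank

namespace ImmersedSubmanifold

theorem IsOrbit.tangentAt_eq {O : ImmersedSubmanifold I M} {p : M} (hO : O.IsOrbit J G p)
    (q : O.carrier) : O.tangentAt q =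
      (actionField I (O.incl q) : GroupLieAlgebra J G →L[ℝ] TangentSpace I (O.incl q)).range := by
  obtain ⟨hr, f, hf, hfs, hfd⟩ := hO
  obtain ⟨g, hg⟩ : O.incl q ∈ MulAction.orbit G p := hr ▸ mem_range_self q
  obtain rfl : q = f g := O.injective_incl (hg.symm.trans (hf g).symm)
  have h1 : ∀ v : TangentSpace J g, (mfderiv J I (fun h : G => h • p) g v : E) =
      mfderiv (𝓡 O.dim) I O.incl (f g) (mfderiv J (𝓡 O.dim) f g v) :=
    mfderiv_apply_of_eq_comp (funext fun h => (hf h).symm)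
      (O.contMDiff_incl.mdifferentiableAt (by simp)) (hfs.mdifferentiableAt (by simp))
  have h2 : (O.tangentAt (f g) : Submodule ℝ E) = (mfderiv J I (fun h : G => h • p) g).range := by
    ext w
    constructor
    · rintro ⟨u, rfl⟩
      obtain ⟨v, rfl⟩ := hfd g u
      exact ⟨v, h1 v⟩
    · rintro ⟨v, rfl⟩
      exact ⟨_, (h1 v).symm⟩
  refine h2.trans ((range_mfderiv_orbitMap g p).trans ?_)
  exact congrArg (β := Submodule ℝ E) (fun x : M => (actionField I x :
    GroupLieAlgebra J G →L[ℝ] TangentSpace I x).range) (hf g).symm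

theorem actionDistribution_le_range (m : Submodule ℝ (GroupLieAlgebra J G)) (x : M) :
    actionDistribution I m x ≤
      (actionField I x : GroupLieAlgebra J G →L[ℝ] TangentSpace I x).range :=
  LinearMap.map_le_range

theorem IsOrbit.mem_regularPart_iff {O : ImmersedSubmanifold I M} {p : M}
    (hO : O.IsOrbit J G p) {m : Submodule ℝ (GroupLieAlgebra J G)} {q : O.carrier} :
    q ∈ O.regularPart m ↔
      (actionField I (O.incl q) : GroupLieAlgebra J G →L[ℝ] TangentSpace I (O.incl q)).range ≤
        actionDistribution I m (O.incl q) := by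
  change actionDistribution I m (O.incl q) = O.tangentAt q ↔ _
  rw [hO.tangentAt_eq]
  exact ⟨fun h => h.ge, fun h => le_antisymm (actionDistribution_le_range m _) h⟩

theorem IsOrbit.isOpen_regularPart {O : ImmersedSubmanifold I M} {p : M}
    (hO : O.IsOrbit J G p) (m : Submodule ℝ (GroupLieAlgebra J G)) :
    IsOpen (O.regularPart m) := by
  have h := (isOpen_setOf_le_finrank_actionDistribution (I := I) (M := M) m O.dim).preimage
    O.contMDiff_incl.continuous
  refine Eq.subst (motive := IsOpen) (Set.ext fun q => Iff.symm ?_) h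
  have hle : actionDistribution I m (O.incl q) ≤ O.tangentAt q :=
    (actionDistribution_le_range m _).trans (hO.tangentAt_eq q).ge
  constructor
  · intro h
    have h : actionDistribution I m (O.incl q) = O.tangentAt q := h
    change O.dim ≤ Module.finrank ℝ (actionDistribution I m (O.incl q))
    rw [h, finrank_tangentAt]
  · intro h
    exact Submodule.eq_of_le_of_finrank_le hle ((O.finrank_tangentAt q).le.trans h)

theorem IsIntegralLeaf.range_actionField {m : Submodule ℝ (GroupLieAlgebra J G)}
    (hm : m ⊔ bracketSpan m = ⊤) {N : ImmersedSubmanifold I M}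
    (hN : N.IsIntegralLeaf (actionDistribution I m)) (x : N.carrier) :
    (actionField I (N.incl x) : GroupLieAlgebra J G →L[ℝ] TangentSpace I (N.incl x)).range ≤
      actionDistribution I m (N.incl x) :=
  range_actionField_le_of_involutiveAt hm (involutiveAt_of_isIntegralLeaf hN x)

/-- A submanifold tangent to the orbits is locally the image of a map to the group. -/
theorem exists_contMDiffAt_smul_eq {N : ImmersedSubmanifold I M}
    (hN : ∀ x, N.tangentAt x = (actionField I (N.incl x) :
      GroupLieAlgebra J G →L[ℝ] TangentSpace I (N.incl x)).range) (x₀ : N.carrier) :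
    ∃ σ : N.carrier → G, ContMDiffAt (𝓡 N.dim) J ∞ σ x₀ ∧
      ∀ᶠ x in 𝓝 x₀, N.incl x = σ x • N.incl x₀ := by
  let Ψ : G × N.carrier → M := fun y => y.1 • N.incl y.2
  have hΨ : ContMDiff (J.prod (𝓡 N.dim)) I ∞ Ψ :=
    contMDiff_fst.smul (I := J) (N.contMDiff_incl.comp contMDiff_snd)
  have hΨd := hΨ.mdifferentiable (by simp)
  have hφ := contMDiff_orbitMap J G I (N.incl x₀)
  have h1 : ∀ x, ((mfderiv (J.prod (𝓡 N.dim)) I Ψ (1, x)).range : Submodule ℝ E) =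
      N.tangentAt x := by
    intro x
    have h2 : ∀ v : EG × EuclideanSpace ℝ (Fin N.dim),
        (mfderiv (J.prod (𝓡 N.dim)) I Ψ (1, x) v : E) =
          (actionField (J := J) (G := G) I (N.incl x) v.1 : E) + (mfderiv (𝓡 N.dim) I N.incl x v.2 : E) := by
      intro v
      refine (mfderiv_prod_eq_add_apply (hΨd (1, x))).trans ?_
      refine congrArg (fun w : E => HAdd.hAdd (α := E) (actionField I (N.incl x) v.1) w) ?_
      have h3 : (fun z => Ψ (1, z)) = N.incl := funext fun z => one_smul G _
      exact congrArg (fun F : N.carrier → M => (mfderiv (𝓡 N.dim) I F x v.2 : E)) h3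
    apply le_antisymm
    · rintro _ ⟨v, rfl⟩
      have h4 : (actionField (J := J) (G := G) I (N.incl x) v.1 : E) ∈ (N.tangentAt x : Submodule ℝ E) := by
        rw [hN x]
        exact ⟨v.1, rfl⟩
      have h5 := Submodule.add_mem (N.tangentAt x : Submodule ℝ E) h4 ⟨v.2, rfl⟩
      exact (congrArg (fun z : E => z ∈ (N.tangentAt x : Submodule ℝ E)) (h2 v)).mpr h5
    · rintro _ ⟨w, rfl⟩
      refine ⟨((0, w) : EG × EuclideanSpace ℝ (Fin N.dim)), (h2 _).trans ?_⟩
      exact (congrArg (fun z : E => z + _) (map_zero (actionField I (N.incl x)))).trans (zero_add _)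
  have hn : ∀ x, Module.finrank ℝ (mfderiv (J.prod (𝓡 N.dim)) I Ψ (1, x)).range = N.dim :=
    fun x => (congrArg (fun S : Submodule ℝ E => Module.finrank ℝ S) (h1 x)).trans
      (N.finrank_tangentAt x)
  obtain ⟨h, W, U, hW, h1W, hh, hU, h1U, hUW, hs, hfib⟩ :=
    exists_submersion_of_finrank_range_mfderiv_le hΨ (1, x₀) (hn x₀) (fun y =>
      (finrank_range_mfderiv_le_of_eq_comp (σ := fun z : M => y.1 • z)
        (τ := fun z => (y.1⁻¹ * z.1, z.2)) hΨd
        ((((contMDiff_mul_left (I := J) (n := ∞)).comp contMDiff_fst).prodMk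
          contMDiff_snd).mdifferentiable (by simp))
        ((ContMDiffSMul.contMDiff_const_smul (I := J) (n := ∞) _).mdifferentiable (by simp))
        (fun z => by simp [Ψ, smul_smul]) (by simp)).trans (hn y.2).le)
  have hU' : IsOpen {g : G | (g, x₀) ∈ U} := hU.preimage (Continuous.prodMk_left x₀)
  have hcomp : ContMDiffOn J (𝓡 N.dim) ∞ (h ∘ fun g : G => g • N.incl x₀) {g : G | (g, x₀) ∈ U} :=
    hh.comp hφ.contMDiffOn fun g hg => hUW hg
  have hd : MDifferentiableAt I (𝓡 N.dim) h ((1 : G) • N.incl x₀) :=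
    (hh.contMDiffAt (hW.mem_nhds h1W)).mdifferentiableAt (by simp)
  obtain ⟨B, s, hB, h1B, hs', hsU, hsec, -⟩ := exists_localSection_of_surjective_mfderiv hU'
    hcomp (x₀ := 1) h1U (by
      rw [mfderiv_comp 1 hd (hφ.mdifferentiableAt (by simp))]
      intro w
      obtain ⟨v, rfl⟩ := hs w
      have h6 : (mfderiv (J.prod (𝓡 N.dim)) I Ψ (1, x₀) v : E) ∈
          (N.tangentAt x₀ : Submodule ℝ E) := by
        rw [← h1 x₀]
        exact ⟨v, rfl⟩
      rw [hN x₀] at h6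
      obtain ⟨u, hu⟩ := h6
      exact ⟨u, congrArg (fun z : E => mfderiv I (𝓡 N.dim) h ((1 : G) • N.incl x₀) z) hu⟩)
  have hι : Ψ (1, x₀) = N.incl x₀ := one_smul G _
  have h1W' : N.incl x₀ ∈ W := hι ▸ h1W
  have h1B' : h (N.incl x₀) ∈ B := hι ▸ h1B
  have hhι : ContMDiffAt (𝓡 N.dim) (𝓡 N.dim) ∞ (h ∘ N.incl) x₀ :=
    (hh.contMDiffAt (hW.mem_nhds h1W')).comp x₀ N.contMDiff_incl.contMDiffAt
  refine ⟨fun x => s (h (N.incl x)),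
    (hs'.contMDiffAt (hB.mem_nhds h1B')).comp x₀ hhι, ?_⟩
  filter_upwards [hhι.continuousAt.preimage_mem_nhds (hB.mem_nhds h1B'),
    (hU.preimage (Continuous.prodMk_right (1 : G))).mem_nhds h1U] with x hxB hxU
  have h7 := hfib _ hxU (s (h (N.incl x)), x₀) (hsU hxB)
    ((congrArg h (one_smul G (N.incl x))).trans (hsec _ hxB).symm)
  exact (one_smul G (N.incl x)).symm.trans h7

/-- A connected submanifold through `p` whose tangent spaces are those of the orbits is an open
submanifold of the orbit of `p`. -/
theorem IsOrbit.isOpenSubmanifoldOf {O N : ImmersedSubmanifold I M} {p : M}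
    (hO : O.IsOrbit J G p) [ConnectedSpace N.carrier]
    (hN : ∀ x, N.tangentAt x = (actionField I (N.incl x) :
      GroupLieAlgebra J G →L[ℝ] TangentSpace I (N.incl x)).range) (hp : p ∈ range N.incl) :
    N.IsOpenSubmanifoldOf O := by
  have hT := hO.tangentAt_eq
  obtain ⟨hr, f, hf, hfs, -⟩ := hO
  obtain ⟨p₁, hp₁⟩ := hp
  have hloc : IsLocallyConstant fun x : N.carrier => MulAction.orbit G (N.incl x) := by
    refine (IsLocallyConstant.iff_eventually_eq _).2 fun x₀ => ?_
    obtain ⟨σ, -, hσ⟩ := exists_contMDiffAt_smul_eq hN x₀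
    filter_upwards [hσ] with x hx
    exact MulAction.orbit_eq_iff.2 ⟨σ x, hx.symm⟩
  have horb : ∀ x, N.incl x ∈ range O.incl := fun x => by
    rw [hr, ← hp₁, ← hloc.apply_eq_of_preconnectedSpace x p₁]
    exact MulAction.mem_orbit_self _
  choose j hj using horb
  have hjs : ContMDiff (𝓡 N.dim) (𝓡 O.dim) ∞ j := by
    intro x₀
    obtain ⟨σ, hσs, hσ⟩ := exists_contMDiffAt_smul_eq hN x₀
    obtain ⟨g, hg⟩ : N.incl x₀ ∈ MulAction.orbit G p := hr ▸ hj x₀ ▸ mem_range_self _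
    have h1 : ContMDiffAt (𝓡 N.dim) (𝓡 O.dim) ∞ (fun x => f (σ x * g)) x₀ :=
      hfs.contMDiffAt.comp x₀ ((contMDiff_mul_right (I := J) (n := ∞)).contMDiffAt.comp x₀ hσs)
    refine h1.congr_of_eventuallyEq ?_
    filter_upwards [hσ] with x hx
    refine O.injective_incl ?_
    rw [hj, hf, mul_smul, hx]
    exact congrArg _ hg.symm
  have hdim : N.dim = O.dim := by
    rw [← N.finrank_tangentAt p₁, ← O.finrank_tangentAt (j p₁), hN p₁, hT (j p₁), hj]
  have hsurj : ∀ x, Function.Surjective (mfderiv (𝓡 N.dim) (𝓡 O.dim) j x) := by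
    intro x
    have h1 := mfderiv_apply_of_eq_comp (F := N.incl) (g := O.incl) (f := j) (x := x)
      (funext fun y => (hj y).symm) (O.contMDiff_incl.mdifferentiableAt (by simp))
      (hjs.mdifferentiableAt (by simp))
    have h2 : Function.Injective (mfderiv (𝓡 N.dim) (𝓡 O.dim) j x) := fun v w hvw =>
      N.injective_mfderiv x ((h1 v).trans ((congrArg (fun z : EuclideanSpace ℝ (Fin O.dim) =>
        (mfderiv (𝓡 O.dim) I O.incl (j x) z : E)) hvw).trans (h1 w).symm))
    refine (LinearMap.injective_iff_surjective_of_finrank_eq_finrank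
      (f := (mfderiv (𝓡 N.dim) (𝓡 O.dim) j x).toLinearMap) ?_).1 h2
    exact finrank_euclideanSpace_fin.trans (hdim.trans finrank_euclideanSpace_fin.symm)
  refine ⟨j, hj, IsOpenEmbedding.of_continuous_injective_isOpenMap hjs.continuous
    (fun x y hxy => N.injective_incl (by rw [← hj, hxy, hj])) (isOpenMap_iff_nhds_le.2 fun x => ?_),
    hjs⟩
  obtain ⟨s, hs, hsx, hjs'⟩ := exists_contMDiffAt_localSection hjs x (hsurj x)
  have h3 := hs.continuousAt.tendsto
  rw [hsx] at h3
  exact le_map_of_right_inverse hjs' h3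

section Leaves

variable {m : Submodule ℝ (GroupLieAlgebra J G)} (hm : m ⊔ bracketSpan m = ⊤)
  {O N : ImmersedSubmanifold I M} {p : M} (hO : O.IsOrbit J G p)
include hm hO

theorem IsOrbit.isOpenSubmanifoldOf_of_isConnectedLeafThrough
    (hN : N.IsConnectedLeafThrough (actionDistribution I m) p) : N.IsOpenSubmanifoldOf O :=
  have := hN.connectedSpace
  hO.isOpenSubmanifoldOf (fun x => (hN.isIntegralLeaf x).trans
    (le_antisymm (actionDistribution_le_range m _)
      (hN.isIntegralLeaf.range_actionField hm x))) hN.mem_range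

variable {p₀ : O.carrier} (hp₀ : O.incl p₀ = p)
include hp₀

theorem IsOrbit.range_subset_connectedComponentIn
    (hN : N.IsConnectedLeafThrough (actionDistribution I m) p) {j : N.carrier → O.carrier}
    (hj : ∀ x, O.incl (j x) = N.incl x) (hjc : Continuous j) :
    range j ⊆ connectedComponentIn (O.regularPart m) p₀ := by
  have := hN.connectedSpace
  refine (isPreconnected_range hjc).subset_connectedComponentIn ?_ ?_
  · obtain ⟨x, hx⟩ := hN.mem_range
    exact ⟨x, O.injective_incl (by rw [hj, hx, hp₀])⟩
  · rintro _ ⟨x, rfl⟩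
    rw [hO.mem_regularPart_iff, hj]
    exact hN.isIntegralLeaf.range_actionField hm x

theorem IsOrbit.exists_isMaximalLeafThrough (hreg : p₀ ∈ O.regularPart m) :
    ∃ L : ImmersedSubmanifold I M, L.IsMaximalLeafThrough (actionDistribution I m) p ∧
      range L.incl = O.incl '' connectedComponentIn (O.regularPart m) p₀ := by
  have : LocallyConnectedSpace O.carrier :=
    ChartedSpace.locallyConnectedSpace (EuclideanSpace ℝ (Fin O.dim)) _
  let C : TopologicalSpace.Opens O.carrier :=
    ⟨connectedComponentIn (O.regularPart m) p₀, (hO.isOpen_regularPart m).connectedComponentIn⟩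
  have hC : ∀ x : C, (x : O.carrier) ∈ O.regularPart m := fun x =>
    connectedComponentIn_subset _ _ x.2
  refine ⟨O.restrict C, ⟨⟨fun x => ?_, ?_, ?_⟩, fun N hN => ?_⟩, ?_⟩
  · exact (O.tangentAt_restrict C x).trans (hC x).symm
  · exact isConnected_iff_connectedSpace.1 (isConnected_connectedComponentIn_iff.2 hreg)
  · exact ⟨⟨p₀, mem_connectedComponentIn hreg⟩, hp₀⟩
  · obtain ⟨j, hj, hjo, hjs⟩ := hO.isOpenSubmanifoldOf_of_isConnectedLeafThrough hm hN
    have hr := hO.range_subset_connectedComponentIn hm hp₀ hN hj hjo.continuous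
    let j' : N.carrier → C := fun x => ⟨j x, hr (mem_range_self x)⟩
    exact ⟨j', hj, IsOpenEmbedding.of_comp j' C.isOpen.isOpenEmbedding_subtypeVal hjo,
      (ContMDiff.subtypeVal_comp_iff (I' := 𝓡 O.dim) C j').1 hjs⟩
  · exact (range_comp O.incl (Subtype.val : C → O.carrier)).trans
      (congrArg (image O.incl) Subtype.range_coe)

theorem IsOrbit.range_eq_of_isMaximalLeafThrough (hreg : p₀ ∈ O.regularPart m)
    {L : ImmersedSubmanifold I M} (hL : L.IsMaximalLeafThrough (actionDistribution I m) p) :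
    range L.incl = O.incl '' connectedComponentIn (O.regularPart m) p₀ := by
  apply Subset.antisymm
  · obtain ⟨j, hj, hjo, -⟩ :=
      hO.isOpenSubmanifoldOf_of_isConnectedLeafThrough hm hL.toIsConnectedLeafThrough
    have hr := hO.range_subset_connectedComponentIn hm hp₀ hL.toIsConnectedLeafThrough hj
      hjo.continuous
    rintro _ ⟨x, rfl⟩
    exact ⟨j x, hr (mem_range_self x), hj x⟩
  · obtain ⟨L₀, hL₀, hr⟩ := hO.exists_isMaximalLeafThrough hm hp₀ hreg
    obtain ⟨j, hj, -⟩ := hL.maximal L₀ hL₀.toIsConnectedLeafThrough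
    rw [← hr]
    rintro _ ⟨x, rfl⟩
    exact ⟨j x, hj x⟩

theorem IsOrbit.tfae_mem_regularPart : List.TFAE [
    InvolutiveAt (actionDistribution I m) p,
    IntegrableAt (actionDistribution I m) p,
    p₀ ∈ O.regularPart m] := by
  tfae_have 1 → 3 := fun h => by
    rw [hO.mem_regularPart_iff, hp₀]
    exact range_actionField_le_of_involutiveAt hm h
  tfae_have 3 → 2 := fun h => by
    obtain ⟨L, hL, -⟩ := hO.exists_isMaximalLeafThrough hm hp₀ h
    exact ⟨L, hL.isIntegralLeaf, hL.mem_range⟩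
  tfae_have 2 → 1 := by
    rintro ⟨N, hN, x, rfl⟩
    exact involutiveAt_of_isIntegralLeaf hN x
  tfae_finish

end Leaves

end ImmersedSubmanifold

end Action

end GManifold

end

theorem mainTheorem6
    {EG : Type*} [NormedAddCommGroup EG] [NormedSpace ℝ EG] [FiniteDimensional ℝ EG]
    {HG : Type*} [TopologicalSpace HG] (J : ModelWithCorners ℝ EG HG) [J.Boundaryless]
    {G : Type*} [TopologicalSpace G] [ChartedSpace HG G] [Group G] [LieGroup J ∞ G]
    [T2Space G] [SecondCountableTopology G]
    {E : Type*} [NormedAddCommGroup E] [NormedSpace ℝ E] [FiniteDimensional ℝ E]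
    {H : Type*} [TopologicalSpace H] (I : ModelWithCorners ℝ E H) [I.Boundaryless]
    {M : Type*} [TopologicalSpace M] [ChartedSpace H M] [IsManifold I ∞ M]
    [T2Space M] [SecondCountableTopology M]
    [MulAction G M] [ContMDiffSMul J I ∞ G M]
    (m : Submodule ℝ (GroupLieAlgebra J G))
    (hm : m ⊔ GManifold.bracketSpan m = ⊤)
    (p : M) :
    (∃ O : GManifold.ImmersedSubmanifold I M, O.IsOrbit J G p) ∧
    ∀ O : GManifold.ImmersedSubmanifold I M, O.IsOrbit J G p →
      ∀ p₀ : O.carrier, O.incl p₀ = p →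
        List.TFAE [
          GManifold.InvolutiveAt (GManifold.actionDistribution I m) p,
          GManifold.IntegrableAt (GManifold.actionDistribution I m) p,
          p₀ ∈ O.regularPart m] ∧
        (p₀ ∈ O.regularPart m →
          (∃ L : GManifold.ImmersedSubmanifold I M,
            L.IsMaximalLeafThrough (GManifold.actionDistribution I m) p) ∧
          ∀ L : GManifold.ImmersedSubmanifold I M,
            L.IsMaximalLeafThrough (GManifold.actionDistribution I m) p →
              L.IsOpenSubmanifoldOf O ∧
              Set.range L.incl = O.incl '' connectedComponentIn (O.regularPart m) p₀) := by
  refine ⟨?_, fun O hO p₀ hp₀ => ⟨hO.tfae_mem_regularPart hm hp₀, fun hreg => ⟨?_, fun L hL =>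
    ⟨hO.isOpenSubmanifoldOf_of_isConnectedLeafThrough hm hL.toIsConnectedLeafThrough,
      hO.range_eq_of_isMaximalLeafThrough hm hp₀ hreg hL⟩⟩⟩⟩
  · obtain ⟨σ⟩ := GManifold.exists_orbitSlice (J := J) (G := G) (I := I) p rfl
    exact ⟨_, σ.isOrbit_toImmersedSubmanifold rfl⟩
  · obtain ⟨L, hL, -⟩ := hO.exists_isMaximalLeafThrough hm hp₀ hreg
    exact ⟨L, hL⟩
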